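/- Let $n\ge 1$. For objects of an additive category $\mathcal C$ and morphisms $X^0\xrightarrow{d^0}X^1\to\cdots\xrightarrow{d^n}X^{n+1}$ in $\mathcal C$, the sequence $(d^1,\dots,d^n)$ is an $n$-cokernel of $d^0$ if $0\to\mathcal C(X^{n+1},Y)\to\mathcal C(X^n,Y)\to\cdots\to\mathcal C(X^0,Y)$ is exact for all $Y\in\mathcal C$; $n$-kernels are defined dually, and the sequence is $n$-exact if $(d^1,\dots,d^n)$ is an $n$-cokernel of $d^0$ and $(d^0,\dots,d^{n-1})$ is an $n$-kernel of $d^n$. An additive category is $n$-abelian if it is idempotent complete, every morphism has an $n$-kernel and an $n$-cokernel, every monomorphism together with any $n$-cokernel of it forms an $n$-exact sequence, and every epimorphism together with any $n$-kernel of it forms an $n$-exact sequence. It is projectively generated if every object $M$ admits an epimorphism $P\to M$ with $P$ projective; injectively cogenerated is the dual notion. For an additive category $\mathcal P$, let $\operatorname{mod}\mathcal P$ be the category of coherent $\mathcal P$-modules, that is, the full subcategory of the category of contravariant functors from $\mathcal P$ to abelian groups whose objects are the functors $G$ for which there are a morphism $f\colon X\to Y$ in $\mathcal P$ and an exact sequence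 $\mathcal P(-,X)\xrightarrow{f}\mathcal P(-,Y)\to G\to 0$. A full subcategory $\mathcal N$ of an abelian category $\mathcal A$ is $n$-cluster-tilting if every object of $\mathcal A$ is a quotient of an object of $\mathcal N$ and a subobject of an object of $\mathcal N$, every object $A$ of $\mathcal A$ has a left $\mathcal N$-approximation (a morphism $A\to N$ with $N\in\mathcal N$ through which every morphism from $A$ to an object of $\mathcal N$ factors; this is covariant finiteness) and a right $\mathcal N$-approximation (the dual notion; this is contravariant finiteness), and $$\mathcal N=\{X\in\mathcal A:\operatorname{Ext}^k_{\mathcal A}(X,\mathcal N)=0\ \text{for } 1\le k\le n-1\}=\{X\in\mathcal A:\operatorname{Ext}^k_{\mathcal A}(\mathcal N,X)=0\ \text{for } 1\le k\le n-1\}.$$ **Theorem.** Let $\mathcal M$ be a small projectively generated $n$-abelian category, let $\mathcal P$ be its full subcategory of projective objects, and let $FX:=\mathcal M(-,X)|_{\mathcal P}$ for $X\in\mathcal M$. Then: 1. $FX$ is coherent for every $X\in\mathcal M$, so that $F$ is a functor $\mathcal M\to\operatorname{mod}\mathcal P$, and the category $\operatorname{mod}\mathcal P$ is abelian. 2. $F\colon\mathcal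 M\to\operatorname{mod}\mathcal P$ is fully faithful. 3. $\operatorname{Ext}^k(FX,FY)=0$ in $\operatorname{mod}\mathcal P$ for all $X,Y\in\mathcal M$ and $1\le k\le n-1$. 4. The essential image $F\mathcal M$ of $F$ satisfies $F\mathcal M=\{X\in\operatorname{mod}\mathcal P:\operatorname{Ext}^k(X,F\mathcal M)=0\text{ for }1\le k\le n-1\}$. 5. $F\mathcal M=\{X\in\operatorname{mod}\mathcal P:\operatorname{Ext}^k(F\mathcal M,X)=0\text{ for }1\le k\le n-1\}$. 6. $F\mathcal M$ is contravariantly finite in $\operatorname{mod}\mathcal P$. 7. If $\operatorname{mod}\mathcal P$ is injectively cogenerated, then $F\mathcal M$ is an $n$-cluster-tilting subcategory of $\operatorname{mod}\mathcal P$; in particular, $F\mathcal M$ is then functorially finite, generating and cogenerating. -/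

import Mathlib

open CategoryTheory CategoryTheory.Limits

universe v u

namespace HigherHomological

/-! ### Weak (co)kernels and `n`-(co)kernels -/

section Sequences

variable {C : Type u} [Category.{v} C] [Preadditive C]

/-- `g : B ⟶ D` is a weak cokernel of `f : A ⟶ B`. -/
def IsWeakCokernel {A B D : C} (f : A ⟶ B) (g : B ⟶ D) : Prop :=
  f ≫ g = 0 ∧ ∀ ⦃Z : C⦄ (h : B ⟶ Z), f ≫ h = 0 → ∃ p : D ⟶ Z, h = g ≫ p

/-- `f : A ⟶ B` is a weak kernel of `g : B ⟶ D`. -/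
def IsWeakKernel {A B D : C} (f : A ⟶ B) (g : B ⟶ D) : Prop :=
  f ≫ g = 0 ∧ ∀ ⦃Z : C⦄ (h : Z ⟶ B), h ≫ g = 0 → ∃ p : Z ⟶ A, h = p ≫ f

variable (C) in
/-- A sequence of morphisms `X 0 ⟶ X 1 ⟶ X 2 ⟶ ⋯`. It is used to write down the finite sequences
`X 0 ⟶ X 1 ⟶ ⋯ ⟶ X (n + 1)`; the notions below, which depend on `n`, involve only the objects
`X 0, …, X (n + 1)` and the morphisms `d 0, …, d n`, the rest of the sequence being irrelevant. -/
structure Sequence where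
  /-- the objects -/
  X : ℕ → C
  /-- the morphisms -/
  d : ∀ k : ℕ, X k ⟶ X (k + 1)

/-- `(d 1, …, d n)` is an `n`-cokernel of `d 0`: for every object `Y` the sequence of abelian groups
`0 ⟶ Hom(X (n + 1), Y) ⟶ Hom(X n, Y) ⟶ ⋯ ⟶ Hom(X 1, Y) ⟶ Hom(X 0, Y)` is exact. Exactness at
`Hom(X (k + 1), Y)` for all `Y`, where `k < n`, says that `d (k + 1)` is a weak cokernel of `d k`;
exactness at `Hom(X (n + 1), Y)` for all `Y` says that `d n` is an epimorphism. -/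
def Sequence.IsNCokernel (S : Sequence C) (n : ℕ) : Prop :=
  (∀ k : ℕ, k < n → IsWeakCokernel (S.d k) (S.d (k + 1))) ∧ Epi (S.d n)

/-- `(d 0, …, d (n - 1))` is an `n`-kernel of `d n`: for every object `Y` the sequence of abelian
groups `0 ⟶ Hom(Y, X 0) ⟶ Hom(Y, X 1) ⟶ ⋯ ⟶ Hom(Y, X n) ⟶ Hom(Y, X (n + 1))` is exact. -/
def Sequence.IsNKernel (S : Sequence C) (n : ℕ) : Prop :=
  (∀ k : ℕ, k < n → IsWeakKernel (S.d k) (S.d (k + 1))) ∧ Mono (S.d 0)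

/-- `X 0 ⟶ X 1 ⟶ ⋯ ⟶ X (n + 1)` is an `n`-exact sequence. -/
def Sequence.IsNExact (S : Sequence C) (n : ℕ) : Prop :=
  S.IsNKernel n ∧ S.IsNCokernel n

variable (C) in
/-- The axioms of an `n`-abelian category (`1 ≤ n`) for an additive category `C`. -/
structure IsNAbelian (n : ℕ) [HasFiniteBiproducts C] : Prop where
  idempotentComplete : IsIdempotentComplete C
  exists_nKernel : ∀ ⦃A B : C⦄ (f : A ⟶ B),
    ∃ S : Sequence C, Arrow.mk (S.d n) = Arrow.mk f ∧ S.IsNKernel n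
  exists_nCokernel : ∀ ⦃A B : C⦄ (f : A ⟶ B),
    ∃ S : Sequence C, Arrow.mk (S.d 0) = Arrow.mk f ∧ S.IsNCokernel n
  nExact_of_mono : ∀ S : Sequence C, Mono (S.d 0) → S.IsNCokernel n → S.IsNExact n
  nExact_of_epi : ∀ S : Sequence C, Epi (S.d n) → S.IsNKernel n → S.IsNExact n

end Sequences

/-! ### Coherent modules -/

section Coherent

variable (C : Type u) [Category.{v} C] [Preadditive C]

/-- A contravariant functor `F` from `C` to abelian groups is coherent if there is an exact sequence
`C(-, X) ⟶ C(-, Y) ⟶ F ⟶ 0` whose first map is induced by a morphism `f : X ⟶ Y` of `C`. (Such a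
functor is automatically additive.) -/
def isCoherent : ObjectProperty (Cᵒᵖ ⥤ AddCommGrpCat.{v}) := fun F =>
  ∃ (X Y : C) (f : X ⟶ Y) (p : preadditiveYoneda.obj Y ⟶ F) (w : preadditiveYoneda.map f ≫ p = 0),
    (ShortComplex.mk (preadditiveYoneda.map f) p w).Exact ∧ Epi p

/-- The category `mod C` of coherent `C`-modules, a full subcategory of the category of all
contravariant functors from `C` to abelian groups. -/
abbrev CohMod := (isCoherent C).FullSubcategory

end Coherent

section Projectives

variable (M : Type u) [Category.{v} M]

/-- The full subcategory of projective objects of `M`. -/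
abbrev Proj := (isProjective M).FullSubcategory

/-- The functor `X ↦ M(-, X)|_P`, where `P` is the category of projective objects of `M`. -/
noncomputable abbrev restrictedYoneda [Preadditive M] :
    M ⥤ (Proj M)ᵒᵖ ⥤ AddCommGrpCat.{v} :=
  preadditiveYoneda ⋙ (Functor.whiskeringLeft _ _ _).obj (isProjective M).ι.op

/-- The functor `X ↦ M(-, X)|_P` with values in `mod P`, given that it takes coherent values. -/
noncomputable abbrev cohYoneda [Preadditive M]
    (hF : ∀ X : M, isCoherent (Proj M) ((restrictedYoneda M).obj X)) : M ⥤ CohMod (Proj M) :=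
  (isCoherent (Proj M)).lift (restrictedYoneda M) hF

end Projectives

/-! ### Cluster-tilting subcategories -/

section ClusterTilting

variable {A : Type u} [Category.{v} A]

/-- Every object of `A` is a quotient of an object of the full subcategory `Q`. -/
def IsGenerating (Q : ObjectProperty A) : Prop :=
  ∀ X : A, ∃ (Y : A) (f : Y ⟶ X), Q Y ∧ Epi f

/-- Every object of `A` is a subobject of an object of the full subcategory `Q`. -/
def IsCogenerating (Q : ObjectProperty A) : Prop :=
  ∀ X : A, ∃ (Y : A) (f : X ⟶ Y), Q Y ∧ Mono f

/-- Every object of `A` has a left `Q`-approximation. -/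
def IsCovariantlyFinite (Q : ObjectProperty A) : Prop :=
  ∀ X : A, ∃ (Y : A) (f : X ⟶ Y), Q Y ∧
    ∀ ⦃Z : A⦄, Q Z → ∀ h : X ⟶ Z, ∃ p : Y ⟶ Z, f ≫ p = h

/-- Every object of `A` has a right `Q`-approximation. -/
def IsContravariantlyFinite (Q : ObjectProperty A) : Prop :=
  ∀ X : A, ∃ (Y : A) (f : Y ⟶ X), Q Y ∧
    ∀ ⦃Z : A⦄, Q Z → ∀ h : Z ⟶ X, ∃ p : Z ⟶ Y, p ≫ f = h

variable [Abelian A]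

/-- `Ext^k(X, Y) = 0` in the abelian category `A`. -/
def ExtVanishes (X Y : A) (k : ℕ) : Prop :=
  letI := HasExt.standard A
  Subsingleton (Abelian.Ext.{max u v} X Y k)

/-- The objects `X` of `A` such that `Ext^k(X, Q) = 0` for all `1 ≤ k ≤ n - 1`. -/
def leftExtPerp (n : ℕ) (Q : ObjectProperty A) : ObjectProperty A := fun X =>
  ∀ k : ℕ, 1 ≤ k → k < n → ∀ Y : A, Q Y → ExtVanishes X Y k

/-- The objects `X` of `A` such that `Ext^k(Q, X) = 0` for all `1 ≤ k ≤ n - 1`. -/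
def rightExtPerp (n : ℕ) (Q : ObjectProperty A) : ObjectProperty A := fun X =>
  ∀ k : ℕ, 1 ≤ k → k < n → ∀ Y : A, Q Y → ExtVanishes Y X k

/-- `Q` is an `n`-cluster-tilting subcategory of the abelian category `A`. -/
structure IsNClusterTilting (n : ℕ) (Q : ObjectProperty A) : Prop where
  generating : IsGenerating Q
  cogenerating : IsCogenerating Q
  covariantlyFinite : IsCovariantlyFinite Q
  contravariantlyFinite : IsContravariantlyFinite Q
  eq_leftExtPerp : Q = leftExtPerp n Q
  eq_rightExtPerp : Q = rightExtPerp n Q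

end ClusterTilting

end HigherHomological

open HigherHomological

/-!
Write `A` for the category of coherent modules over the projective objects of `M` and `Q` for the
essential image of `F = M(-, -)|_P`. The proof separates three matters.

*Coherent functors.* Weak kernels in `M`, covered by projective objects, are weak kernels in the
category of projective objects, and they provide presentations of kernels of morphisms of coherent
functors. So coherent functors are closed under kernels, cokernels and finite products among all
functors, and `A` is abelian. An epimorphism in `M` is a weak cokernel of a weak kernel of it, and
this makes `F` full.

*The functor `F`.* It takes weak kernels to exact sequences and projectives to projectives, and
every object of `A` is the cokernel of some `F f` (`isPresentingFunctor_cohYoneda`). Hence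
`n`-kernels give resolutions and `n`-cokernels of monomorphisms give coresolutions by objects of
`Q`. An `n`-exact sequence ending with an epimorphism from a projective object onto `X` computes
`Ext^k(F X, F Y)` by dimension shifting, and the weak cokernel property makes it vanish for
`1 ≤ k < n` (`IsPresentingFunctor.extVanishes`).

*Resolutions.* The rest is homological algebra in `A`. An `n`-kernel of a presentation of `X` is a
resolution with `n + 2` objects of `Q`. It can be shortened: an object with a resolution by `r + 1`
objects embeds into one with a resolution by `r` objects, the quotient having a coresolution of
length `n - r` (`HasResolution.exists_shortExact`), and this quotient vanishes for `r = n`. The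
induction uses only pushouts of short exact sequences and the vanishing of `Ext^1` of the quotient
with coefficients in `Q`. So every object has a resolution by `n` objects of `Q`. Its first map is a
right approximation, and it splits if `Ext^k(X, Q) = 0` for `1 ≤ k < n`. If instead
`Ext^k(Q, X) = 0` for these `k`, then the first syzygy inherits this property and lies in `Q` by
induction; so `X` is the quotient of a monomorphism in `Q`, has a coresolution, and the first map of
the coresolution splits (`HasResolution.prop_of_rightExtPerp`).
-/

namespace HigherHomological

/-! ### Vanishing of Ext-groups along short exact sequences -/

section ExtVanishing

variable {A : Type u} [Category.{v} A] [Abelian A]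

theorem extVanishes_iff {X Y : A} {k : ℕ} :
    ExtVanishes X Y k ↔ letI := HasExt.standard A
      ∀ e : Abelian.Ext.{max u v} X Y k, e = 0 := by
  let := HasExt.standard A
  exact ⟨fun h e => h.elim _ _, fun h => ⟨fun a b => (h a).trans (h b).symm⟩⟩

namespace ExtVanishes

theorem of_projective (P Y : A) [Projective P] {k : ℕ} (hk : 1 ≤ k) : ExtVanishes P Y k := by
  let := HasExt.standard A
  obtain ⟨k, rfl⟩ := Nat.exists_eq_add_of_le' hk
  exact extVanishes_iff.2 fun e => e.eq_zero_of_projective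

theorem of_injective (X I : A) [Injective I] {k : ℕ} (hk : 1 ≤ k) : ExtVanishes X I k := by
  let := HasExt.standard A
  obtain ⟨k, rfl⟩ := Nat.exists_eq_add_of_le' hk
  exact extVanishes_iff.2 fun e => e.eq_zero_of_injective

theorem of_iso {X X' Y Y' : A} {k : ℕ} (h : ExtVanishes X Y k) (e : X ≅ X') (e' : Y ≅ Y') :
    ExtVanishes X' Y' k := by
  let := HasExt.standard A
  rw [extVanishes_iff] at h ⊢
  intro x
  have hx : x = (Abelian.Ext.mk₀ e.inv).comp (((Abelian.Ext.mk₀ e.hom).comp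
      (x.comp (Abelian.Ext.mk₀ e'.inv) (add_zero k)) (zero_add k)).comp
        (Abelian.Ext.mk₀ e'.hom) (add_zero k)) (zero_add k) := by
    simp
  rw [hx, h ((Abelian.Ext.mk₀ e.hom).comp _ (zero_add k))]
  simp

theorem of_isZero_left {X : A} (hX : IsZero X) (Y : A) (k : ℕ) : ExtVanishes X Y k := by
  let := HasExt.standard A
  rw [extVanishes_iff]
  intro x
  have hx : (Abelian.Ext.mk₀ (𝟙 X)).comp x (zero_add k) = x := by simp
  rw [← hx, hX.eq_of_src (𝟙 X) 0]
  simp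

variable {K N X : A} {i : K ⟶ N} {p : N ⟶ X} {w : i ≫ p = 0}

theorem extension_of_shortExact (hS : (ShortComplex.mk i p w).ShortExact) {Y : A}
    (h : ExtVanishes X Y 1) (f : K ⟶ Y) : ∃ g : N ⟶ Y, i ≫ g = f := by
  let := HasExt.standard A
  rw [extVanishes_iff] at h
  obtain ⟨x, hx⟩ := Abelian.Ext.contravariant_sequence_exact₁ hS Y (Abelian.Ext.mk₀ f)
    (n₁ := 1) rfl (h _)
  obtain ⟨g, rfl⟩ := Abelian.Ext.addEquiv₀.symm.surjective x
  refine ⟨g, Abelian.Ext.addEquiv₀.symm.injective ?_⟩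
  simpa using hx

theorem lift_of_shortExact (hS : (ShortComplex.mk i p w).ShortExact) {W : A}
    (h : ExtVanishes W K 1) (f : W ⟶ X) : ∃ g : W ⟶ N, g ≫ p = f := by
  let := HasExt.standard A
  rw [extVanishes_iff] at h
  obtain ⟨x, hx⟩ := Abelian.Ext.covariant_sequence_exact₃ W hS (Abelian.Ext.mk₀ f)
    (n₁ := 1) rfl (h _)
  obtain ⟨g, rfl⟩ := Abelian.Ext.addEquiv₀.symm.surjective x
  refine ⟨g, Abelian.Ext.addEquiv₀.symm.injective ?_⟩
  simpa using hx

theorem left_of_shortExact (hS : (ShortComplex.mk i p w).ShortExact) {Y : A} {k : ℕ}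
    (h₁ : ExtVanishes N Y k) (h₂ : ExtVanishes X Y (k + 1)) : ExtVanishes K Y k := by
  let := HasExt.standard A
  rw [extVanishes_iff] at *
  intro x
  obtain ⟨y, rfl⟩ := Abelian.Ext.contravariant_sequence_exact₁ hS Y x (add_comm 1 k) (h₂ _)
  rw [h₁ y, Abelian.Ext.comp_zero]

theorem right_of_shortExact (hS : (ShortComplex.mk i p w).ShortExact) {Y : A} {k : ℕ}
    (h₁ : ExtVanishes K Y k) (h₂ : ExtVanishes N Y (k + 1)) : ExtVanishes X Y (k + 1) := by
  let := HasExt.standard A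
  rw [extVanishes_iff] at *
  intro x
  obtain ⟨y, rfl⟩ := Abelian.Ext.contravariant_sequence_exact₃ hS Y x (h₂ _) (add_comm 1 k)
  rw [h₁ y, Abelian.Ext.comp_zero]

theorem right_one_of_extension (hS : (ShortComplex.mk i p w).ShortExact) {Y : A}
    (h₁ : ∀ f : K ⟶ Y, ∃ g : N ⟶ Y, i ≫ g = f) (h₂ : ExtVanishes N Y 1) :
    ExtVanishes X Y 1 := by
  let := HasExt.standard A
  rw [extVanishes_iff] at *
  intro x
  obtain ⟨y, rfl⟩ := Abelian.Ext.contravariant_sequence_exact₃ hS Y x (h₂ _) (add_zero 1)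
  obtain ⟨f, rfl⟩ := Abelian.Ext.addEquiv₀.symm.surjective y
  obtain ⟨g, rfl⟩ := h₁ f
  have h0 := hS.extClass_comp
  dsimp at h0
  have : Abelian.Ext.addEquiv₀.symm (i ≫ g) =
      (Abelian.Ext.mk₀ i).comp (Abelian.Ext.mk₀ g) (add_zero 0) := by simp
  rw [this, ← Abelian.Ext.comp_assoc hS.extClass (Abelian.Ext.mk₀ i) (Abelian.Ext.mk₀ g)
    (add_zero 1) (add_zero 0) (by lia), h0, Abelian.Ext.zero_comp]

theorem sub_of_shortExact (hS : (ShortComplex.mk i p w).ShortExact) {W : A} {k : ℕ}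
    (h₁ : ExtVanishes W X k) (h₂ : ExtVanishes W N (k + 1)) : ExtVanishes W K (k + 1) := by
  let := HasExt.standard A
  rw [extVanishes_iff] at *
  intro x
  obtain ⟨y, rfl⟩ := Abelian.Ext.covariant_sequence_exact₁ W hS x (h₂ _) rfl
  rw [h₁ y, Abelian.Ext.zero_comp]

theorem sub_one_of_lift (hS : (ShortComplex.mk i p w).ShortExact) {W : A}
    (h₁ : ∀ f : W ⟶ X, ∃ g : W ⟶ N, g ≫ p = f) (h₂ : ExtVanishes W N 1) :
    ExtVanishes W K 1 := by
  let := HasExt.standard A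
  rw [extVanishes_iff] at *
  intro x
  obtain ⟨y, rfl⟩ := Abelian.Ext.covariant_sequence_exact₁ W hS x (h₂ _) (zero_add 1)
  obtain ⟨f, rfl⟩ := Abelian.Ext.addEquiv₀.symm.surjective y
  obtain ⟨g, rfl⟩ := h₁ f
  have h0 := hS.comp_extClass
  dsimp at h0
  have : Abelian.Ext.addEquiv₀.symm (g ≫ p) =
      (Abelian.Ext.mk₀ g).comp (Abelian.Ext.mk₀ p) (add_zero 0) := by simp
  rw [this, Abelian.Ext.comp_assoc (Abelian.Ext.mk₀ g) (Abelian.Ext.mk₀ p) hS.extClass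
    (add_zero 0) (zero_add 1) (by lia), h0, Abelian.Ext.comp_zero]

theorem quotient_of_shortExact (hS : (ShortComplex.mk i p w).ShortExact) {W : A} {k : ℕ}
    (h₁ : ExtVanishes W N k) (h₂ : ExtVanishes W K (k + 1)) : ExtVanishes W X k := by
  let := HasExt.standard A
  rw [extVanishes_iff] at *
  intro x
  obtain ⟨y, rfl⟩ := Abelian.Ext.covariant_sequence_exact₃ W hS x rfl (h₂ _)
  rw [h₁ y, Abelian.Ext.zero_comp]

end ExtVanishes

end ExtVanishing

/-! ### Finite resolutions and coresolutions by objects of a subcategory -/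

section Resolutions

variable {A : Type u} [Category.{v} A] [Abelian A]

/-- Given short exact sequences `0 ⟶ Z ⟶ T ⟶ C ⟶ 0`, `0 ⟶ Z ⟶ N ⟶ Z' ⟶ 0` and
`0 ⟶ C ⟶ N' ⟶ C' ⟶ 0` such that `Z ⟶ N` extends to `T`, the object `T` embeds into `N ⊞ N'`, and
the quotient `T'` is an extension of `C'` by `Z'`. -/
theorem exists_shortExact_biprod {Z T C N Z' N' C' : A} {i : Z ⟶ T} {p : T ⟶ C} {w₁ : i ≫ p = 0}
    (h₁ : (ShortComplex.mk i p w₁).ShortExact) {j : Z ⟶ N} {q : N ⟶ Z'} {w₂ : j ≫ q = 0}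
    (h₂ : (ShortComplex.mk j q w₂).ShortExact) {k : C ⟶ N'} {r : N' ⟶ C'} {w₃ : k ≫ r = 0}
    (h₃ : (ShortComplex.mk k r w₃).ShortExact) {e : T ⟶ N} (he : i ≫ e = j) :
    ∃ (T' : A) (m : T ⟶ N ⊞ N') (π : N ⊞ N' ⟶ T') (w : m ≫ π = 0) (a : Z' ⟶ T') (b : T' ⟶ C')
      (w' : a ≫ b = 0),
      (ShortComplex.mk m π w).ShortExact ∧ (ShortComplex.mk a b w').ShortExact := by
  have := h₁.mono_f
  have := h₁.epi_g
  have := h₂.mono_f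
  have := h₂.epi_g
  have := h₃.mono_f
  have := h₃.epi_g
  dsimp at *
  let m : T ⟶ N ⊞ N' := biprod.lift e (p ≫ k)
  have hm : Mono m := by
    refine Preadditive.mono_of_cancel_zero _ fun {G} t ht => ?_
    have ht₁ : t ≫ e = 0 := by simpa [m] using ht =≫ biprod.fst
    have ht₂ : t ≫ p = 0 := by
      rw [← cancel_mono k]
      simpa [m] using ht =≫ biprod.snd
    obtain ⟨s, hs⟩ := h₁.exact.lift' t ht₂
    dsimp at s hs
    have : s ≫ j = 0 := by rw [← he, reassoc_of% hs, ht₁]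
    rw [← hs, (cancel_mono j).1 (this.trans zero_comp.symm), zero_comp]
  have him : i ≫ m = j ≫ biprod.inl := by
    ext <;> simp [m, he, reassoc_of% w₁]
  let a : Z' ⟶ cokernel m := h₂.exact.desc (biprod.inl ≫ cokernel.π m) (by
    dsimp
    rw [← Category.assoc, ← him, Category.assoc, cokernel.condition, comp_zero])
  have ha : q ≫ a = biprod.inl ≫ cokernel.π m := h₂.exact.g_desc _ _
  let b : cokernel m ⟶ C' := cokernel.desc m (biprod.snd ≫ r) (by simp [m, w₃])
  have hb : cokernel.π m ≫ b = biprod.snd ≫ r := cokernel.π_desc _ _ _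
  have hab : a ≫ b = 0 := by
    rw [← cancel_epi q, reassoc_of% ha, hb]
    simp
  have hSm : (ShortComplex.mk m (cokernel.π m) (cokernel.condition m)).ShortExact :=
    { exact := ShortComplex.exact_cokernel m }
  refine ⟨cokernel m, m, cokernel.π m, cokernel.condition m, a, b, hab, hSm, ?_⟩
  have hepi : Epi b := by
    have : Epi (cokernel.π m ≫ b) := by rw [hb]; infer_instance
    exact epi_of_epi (cokernel.π m) b
  have hmono : Mono a := by
    refine Preadditive.mono_of_cancel_zero _ fun {G} t ht => ?_
    obtain ⟨G', f, _, s, hs⟩ := surjective_up_to_refinements_of_epi q t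
    have h0 : (s ≫ biprod.inl) ≫ cokernel.π m = 0 := by
      rw [Category.assoc, ← ha, ← reassoc_of% hs, ht, comp_zero]
    obtain ⟨G'', f', _, x, hx⟩ := hSm.exact.exact_up_to_refinements _ h0
    dsimp at x hx
    have hx₁ : f' ≫ s = x ≫ e := by simpa [m] using hx =≫ biprod.fst
    have hx₂ : x ≫ p = 0 := by
      rw [← cancel_mono k]
      simpa [m] using (hx =≫ biprod.snd).symm
    obtain ⟨y, hy⟩ := h₁.exact.lift' x hx₂
    dsimp at y hy
    rw [← cancel_epi f, ← cancel_epi f', hs, ← Category.assoc, hx₁, ← hy]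
    simp [reassoc_of% he, w₂]
  refine { exact := ?_ }
  rw [ShortComplex.exact_iff_exact_up_to_refinements]
  intro G t ht
  dsimp at t ht
  obtain ⟨G', f, _, s, hs⟩ := surjective_up_to_refinements_of_epi (cokernel.π m) t
  have h0 : (s ≫ biprod.snd) ≫ r = 0 := by
    rw [Category.assoc, ← hb, ← reassoc_of% hs, ht, comp_zero]
  obtain ⟨x, hx⟩ := h₃.exact.lift' _ h0
  dsimp at x hx
  obtain ⟨G'', f', _, y, hy⟩ := surjective_up_to_refinements_of_epi p x
  -- modulo the image of `T`, the element `s` of `N ⊞ N'` may be moved into `N`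
  have key : f' ≫ s = y ≫ m + (f' ≫ s ≫ biprod.fst - y ≫ e) ≫ biprod.inl := by
    ext
    · simp [m]
    · simp [m, ← reassoc_of% hy, hx]
  refine ⟨G'', f' ≫ f, inferInstance, (f' ≫ s ≫ biprod.fst - y ≫ e) ≫ q, ?_⟩
  dsimp
  rw [Category.assoc, Category.assoc, ha, hs, ← Category.assoc f', key]
  simp

variable (Q : ObjectProperty A)

/-- `HasResolution Q r X` says that there is an exact sequence
`0 ⟶ N_r ⟶ ⋯ ⟶ N_1 ⟶ N_0 ⟶ X ⟶ 0` with all `N_i` in `Q`; it is cut into short exact sequences. -/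
def HasResolution : ℕ → ObjectProperty A
  | 0 => Q
  | r + 1 => fun X => ∃ (K N : A) (i : K ⟶ N) (p : N ⟶ X) (w : i ≫ p = 0),
      (ShortComplex.mk i p w).ShortExact ∧ HasResolution r K ∧ Q N

/-- `HasCoresolution Q s X` says that there is an exact sequence
`0 ⟶ X ⟶ N_1 ⟶ ⋯ ⟶ N_s ⟶ 0` with all `N_i` in `Q`; it is cut into short exact sequences. -/
def HasCoresolution : ℕ → ObjectProperty A
  | 0 => fun X => IsZero X
  | s + 1 => fun X => ∃ (N C : A) (i : X ⟶ N) (p : N ⟶ C) (w : i ≫ p = 0),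
      (ShortComplex.mk i p w).ShortExact ∧ Q N ∧ HasCoresolution s C

variable {Q}

theorem HasResolution.of_iso [Q.IsClosedUnderIsomorphisms] {r : ℕ} {X Y : A} (e : X ≅ Y)
    (h : HasResolution Q r X) : HasResolution Q r Y := by
  cases r with
  | zero => exact Q.prop_of_iso e h
  | succ r =>
    obtain ⟨K, N, i, p, w, hS, hK, hN⟩ := h
    refine ⟨K, N, i, p ≫ e.hom, by rw [← Category.assoc, w, zero_comp], ?_, hK, hN⟩
    have e' : ShortComplex.mk i p w ≅ ShortComplex.mk i (p ≫ e.hom)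
        (by rw [← Category.assoc, w, zero_comp]) :=
      ShortComplex.isoMk (Iso.refl _) (Iso.refl _) e
    exact ShortComplex.shortExact_of_iso e' hS

theorem HasCoresolution.of_iso {s : ℕ} {X Y : A} (e : X ≅ Y)
    (h : HasCoresolution Q s X) : HasCoresolution Q s Y := by
  cases s with
  | zero => exact IsZero.of_iso h e.symm
  | succ s =>
    obtain ⟨N, C, i, p, w, hS, hN, hC⟩ := h
    refine ⟨N, C, e.inv ≫ i, p, by rw [Category.assoc, w, comp_zero], ?_, hN, hC⟩
    have e' : ShortComplex.mk i p w ≅ ShortComplex.mk (e.inv ≫ i) p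
        (by rw [Category.assoc, w, comp_zero]) :=
      ShortComplex.isoMk e (Iso.refl _) (Iso.refl _)
    exact ShortComplex.shortExact_of_iso e' hS

theorem HasCoresolution.extVanishes {n s : ℕ} {C E : A} (hC : HasCoresolution Q s C)
    (hE : rightExtPerp n Q E) {k : ℕ} (hk : 1 ≤ k) (hks : k + s ≤ n) : ExtVanishes C E k := by
  induction s generalizing C k with
  | zero => exact .of_isZero_left hC _ _
  | succ s ih =>
    obtain ⟨N, C', i, p, w, hS, hN, hC'⟩ := hC
    exact .left_of_shortExact hS (hE k hk (by lia) N hN) (ih hC' (by lia) (by lia))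

theorem HasResolution.extVanishes {n r : ℕ} {W K : A} (hK : HasResolution Q r K)
    (hW : leftExtPerp n Q W) {k : ℕ} (hk : 1 ≤ k) (hkr : k + r < n) : ExtVanishes W K k := by
  induction r generalizing K k with
  | zero => exact hW k hk (by lia) K hK
  | succ r ih =>
    obtain ⟨K', N, i, p, w, hS, hK', hN⟩ := hK
    exact .quotient_of_shortExact hS (hW k hk (by lia) N hN) (ih hK' (by lia) (by lia))

variable {n : ℕ}

/-- The inductive step which trades a resolution of length `r` for a shorter one: an object with a
resolution of length `r` embeds into an object with a resolution of length `r - 1`, the quotient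
having a coresolution of length `n - r`. -/
theorem HasResolution.exists_shortExact [Q.IsClosedUnderBinaryProducts]
    (hext : ∀ X, Q X → rightExtPerp n Q X)
    (hcores : ∀ ⦃N₁ N₀ X : A⦄ (i : N₁ ⟶ N₀) (p : N₀ ⟶ X) (w : i ≫ p = 0),
      (ShortComplex.mk i p w).ShortExact → Q N₁ → Q N₀ → HasCoresolution Q n X)
    {r : ℕ} (hr : r + 1 ≤ n) {X : A} (hX : HasResolution Q (r + 1) X) :
    ∃ (T C : A) (i : X ⟶ T) (p : T ⟶ C) (w : i ≫ p = 0), (ShortComplex.mk i p w).ShortExact ∧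
      HasResolution Q r T ∧ HasCoresolution Q (n - (r + 1)) C := by
  induction r generalizing X with
  | zero =>
    obtain ⟨N₁, N₀, i, p, w, hS, hN₁, hN₀⟩ := hX
    have h := hcores i p w hS hN₁ hN₀
    obtain ⟨m, rfl⟩ := Nat.exists_eq_add_of_le' hr
    obtain ⟨N, C, j, q, w', hS', hN, hC⟩ := h
    exact ⟨N, C, j, q, w', hS', hN, hC⟩
  | succ r ih =>
    obtain ⟨K, N, j, q, w₂, h₂, hK, hN⟩ := hX
    obtain ⟨T, C, i, p, w₁, h₁, hT, hC⟩ := ih (by lia) hK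
    obtain ⟨m, hm⟩ := Nat.exists_eq_add_of_le hr
    obtain rfl : n = r + 1 + 1 + m := hm
    have hm' : r + 1 + 1 + m - (r + 1) = m + 1 := by lia
    have hm'' : r + 1 + 1 + m - (r + 1 + 1) = m := by lia
    rw [hm'] at hC
    rw [hm'']
    -- `Ext^1(C, N) = 0`, by dimension shifting along the coresolution of `C`
    obtain ⟨e, he⟩ := ExtVanishes.extension_of_shortExact h₁
      (hC.extVanishes (hext N hN) le_rfl (by lia)) j
    obtain ⟨N', C', k, s, w₃, h₃, hN', hC'⟩ := hC
    obtain ⟨T', μ, π, w, a, b, w', hT', hab⟩ := exists_shortExact_biprod h₁ h₂ h₃ he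
    refine ⟨T', C', a, b, w', hab, ⟨T, N ⊞ N', μ, π, w, hT', hT, ?_⟩, hC'⟩
    exact Q.prop_of_isLimit_binaryFan (BinaryBiproduct.isLimit N N') hN hN'

/-- At the last step of the induction the quotient in `HasResolution.exists_shortExact` has a
coresolution of length zero, so it vanishes, and the resolution is shortened. -/
theorem HasResolution.of_succ [Q.IsClosedUnderIsomorphisms] [Q.IsClosedUnderBinaryProducts]
    (hext : ∀ X, Q X → rightExtPerp (n + 1) Q X)
    (hcores : ∀ ⦃N₁ N₀ X : A⦄ (i : N₁ ⟶ N₀) (p : N₀ ⟶ X) (w : i ≫ p = 0),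
      (ShortComplex.mk i p w).ShortExact → Q N₁ → Q N₀ → HasCoresolution Q (n + 1) X)
    {X : A} (hX : HasResolution Q (n + 1) X) : HasResolution Q n X := by
  obtain ⟨T, C, i, p, w, hS, hT, hC⟩ := hX.exists_shortExact hext hcores le_rfl
  rw [Nat.sub_self] at hC
  have : IsIso i := hS.isIso_f_iff.2 hC
  exact hT.of_iso (asIso i).symm

theorem hasResolution_of_forall_hasResolution [Q.IsClosedUnderIsomorphisms]
    [Q.IsClosedUnderBinaryProducts]
    (hext : ∀ X, Q X → rightExtPerp (n + 1) Q X)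
    (hcores : ∀ ⦃N₁ N₀ X : A⦄ (i : N₁ ⟶ N₀) (p : N₀ ⟶ X) (w : i ≫ p = 0),
      (ShortComplex.mk i p w).ShortExact → Q N₁ → Q N₀ → HasCoresolution Q (n + 1) X)
    (hres : ∀ X, HasResolution Q (n + 2) X) (X : A) : HasResolution Q n X := by
  obtain ⟨K, N, i, p, w, hS, hK, hN⟩ := hres X
  exact HasResolution.of_succ hext hcores
    ⟨K, N, i, p, w, hS, HasResolution.of_succ hext hcores hK, hN⟩

/-- The first map `N ⟶ X` of a resolution is a right approximation: the obstruction to lifting a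
morphism from `Z` lies in `Ext^1(Z, K)` for the first syzygy `K`, and dimension shifting takes it to
a group `Ext^n(Z, N')` with `N'` in `Q`. -/
theorem isContravariantlyFinite_of_hasResolution (hext : ∀ X, Q X → leftExtPerp (n + 1) Q X)
    (hres : ∀ X, HasResolution Q n X) : IsContravariantlyFinite Q := by
  intro X
  cases n with
  | zero => exact ⟨X, 𝟙 X, hres X, fun Z _ h => ⟨h, Category.comp_id h⟩⟩
  | succ n =>
    obtain ⟨K, N, i, p, w, hS, hK, hN⟩ := hres X
    exact ⟨N, p, hN, fun Z hZ h =>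
      ExtVanishes.lift_of_shortExact hS (hK.extVanishes (hext Z hZ) le_rfl (by lia)) h⟩

/-- If `Ext^k(X, Q) = 0` for `1 ≤ k ≤ n`, then `Ext^1(X, K) = 0` for the first syzygy `K` of a
resolution of `X`, so that `X` is a retract of an object of `Q`. -/
theorem eq_leftExtPerp_of_hasResolution [Q.IsStableUnderRetracts]
    (hext : ∀ X, Q X → leftExtPerp (n + 1) Q X)
    (hres : ∀ X, HasResolution Q n X) : Q = leftExtPerp (n + 1) Q := by
  refine le_antisymm hext fun X hX => ?_
  cases n with
  | zero => exact hres X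
  | succ n =>
    obtain ⟨K, N, i, p, w, hS, hK, hN⟩ := hres X
    obtain ⟨g, hg⟩ := ExtVanishes.lift_of_shortExact hS
      (hK.extVanishes hX le_rfl (by lia)) (𝟙 X)
    exact Q.prop_of_retract ⟨g, p, hg⟩ hN

/-- An object `X` with `Ext^k(Q, X) = 0` which has a resolution of length at most `n` lies in `Q`:
the first syzygy inherits both properties, so it lies in `Q` by induction. Then `X` is a quotient
of two objects of `Q` and has a coresolution, whose first map `X ⟶ N` splits. -/
theorem HasResolution.prop_of_rightExtPerp [Q.IsStableUnderRetracts]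
    (hext : ∀ X, Q X → leftExtPerp (n + 1) Q X)
    (hcores : ∀ ⦃N₁ N₀ X : A⦄ (i : N₁ ⟶ N₀) (p : N₀ ⟶ X) (w : i ≫ p = 0),
      (ShortComplex.mk i p w).ShortExact → Q N₁ → Q N₀ → HasCoresolution Q (n + 1) X)
    {r : ℕ} (hr : r ≤ n) {X : A} (hX : HasResolution Q r X) (hX' : rightExtPerp (n + 1) Q X) :
    Q X := by
  induction r generalizing X with
  | zero => exact hX
  | succ r ih =>
    obtain ⟨K, N, i, p, w, hS, hK, hN⟩ := hX
    have hK' : rightExtPerp (n + 1) Q K := by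
      intro k hk hkn W hW
      obtain ⟨k, rfl⟩ := Nat.exists_eq_add_of_le' hk
      have hWN := hext W hW (k + 1) hk hkn N hN
      cases k with
      | zero =>
        exact .sub_one_of_lift hS (fun f => ExtVanishes.lift_of_shortExact hS
          (hK.extVanishes (hext W hW) le_rfl (by lia)) f) hWN
      | succ k => exact .sub_of_shortExact hS (hX' (k + 1) (by lia) (by lia) W hW) hWN
    obtain ⟨N', C, j, q, w', hS', hN', hC⟩ := hcores i p w hS (ih (by lia) hK hK') hN
    obtain ⟨g, hg⟩ := ExtVanishes.extension_of_shortExact hS'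
      (hC.extVanishes hX' le_rfl (by lia)) (𝟙 X)
    exact Q.prop_of_retract ⟨j, g, hg⟩ hN'

theorem eq_rightExtPerp_of_hasResolution [Q.IsStableUnderRetracts]
    (hext : ∀ X, Q X → leftExtPerp (n + 1) Q X) (hext' : ∀ X, Q X → rightExtPerp (n + 1) Q X)
    (hcores : ∀ ⦃N₁ N₀ X : A⦄ (i : N₁ ⟶ N₀) (p : N₀ ⟶ X) (w : i ≫ p = 0),
      (ShortComplex.mk i p w).ShortExact → Q N₁ → Q N₀ → HasCoresolution Q (n + 1) X)
    (hres : ∀ X, HasResolution Q n X) : Q = rightExtPerp (n + 1) Q :=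
  le_antisymm hext' fun X hX => (hres X).prop_of_rightExtPerp hext hcores le_rfl hX

end Resolutions

/-! ### Embeddings of `n`-abelian categories into abelian categories -/

universe v' u'

section Embedding

variable {A : Type u'} [Category.{v'} A] [Abelian A]

theorem shortExact_cokernel_of_exact {X Y Z : A} (f : X ⟶ Y) (g : Y ⟶ Z) (w : f ≫ g = 0)
    (h : (ShortComplex.mk f g w).Exact) :
    (ShortComplex.mk (cokernel.desc f g w) (cokernel.π g)
      (by rw [← cancel_epi (cokernel.π f)]; simp)).ShortExact := by
  have : Mono (cokernel.desc f g w) := h.mono_cokernelDesc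
  refine { exact := ?_ }
  rw [ShortComplex.exact_iff_exact_up_to_refinements]
  intro T t ht
  obtain ⟨T', e, he, r, hr⟩ := (ShortComplex.exact_cokernel g).exact_up_to_refinements t ht
  exact ⟨T', e, he, r ≫ cokernel.π f, by simpa using hr⟩

variable {M : Type u} [Category.{v} M] [Preadditive M] (F : M ⥤ A)

/-- A functor to an abelian category which behaves like `X ↦ M(-, X)|_P`: it is exact on sequences
given by weak kernels, it preserves epimorphisms and projective objects, and every object of the
target is the cokernel of a morphism in its image. -/
structure IsPresentingFunctor : Prop where
  exact_of_isWeakKernel : ∀ ⦃X Y Z : M⦄ (f : X ⟶ Y) (g : Y ⟶ Z), IsWeakKernel f g →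
    ∀ w : F.map f ≫ F.map g = 0, (ShortComplex.mk (F.map f) (F.map g) w).Exact
  epi_map : ∀ ⦃X Y : M⦄ (f : X ⟶ Y), Epi f → Epi (F.map f)
  projective_obj : ∀ P : M, Projective P → Projective (F.obj P)
  exists_presentation : ∀ X : A, ∃ (U V : M) (f : U ⟶ V) (p : F.obj V ⟶ X) (w : F.map f ≫ p = 0),
    (ShortComplex.mk (F.map f) p w).Exact ∧ Epi p

variable {F}

theorem map_comp_eq_zero [F.Additive] {X Y Z : M} {f : X ⟶ Y} {g : Y ⟶ Z} (w : f ≫ g = 0) :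
    F.map f ≫ F.map g = 0 := by
  rw [← F.map_comp, w, F.map_zero]

theorem IsPresentingFunctor.mono_map [F.Additive] (hF : IsPresentingFunctor F) {X Y : M}
    (f : X ⟶ Y) [Mono f] : Mono (F.map f) := by
  have h : IsWeakKernel (0 : X ⟶ X) f :=
    ⟨zero_comp, fun Z h hh => ⟨0, by
      rw [zero_comp]; exact (cancel_mono f).1 (hh.trans zero_comp.symm)⟩⟩
  exact (hF.exact_of_isWeakKernel _ _ h (map_comp_eq_zero h.1)).mono_g (F.map_zero _ _)

theorem isClosedUnderBinaryProducts_essImage [HasFiniteBiproducts M] [F.Additive] :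
    F.essImage.IsClosedUnderBinaryProducts where
  limitsOfShape_le := by
    rintro X ⟨pres⟩
    obtain ⟨U, ⟨e⟩⟩ := pres.prop_diag_obj ⟨.left⟩
    obtain ⟨V, ⟨e'⟩⟩ := pres.prop_diag_obj ⟨.right⟩
    have := hasBinaryBiproducts_of_finite_biproducts M
    have : PreservesBinaryBiproducts F := preservesBinaryBiproducts_of_preservesBiproducts F
    have i₁ : X ≅ pres.diag.obj ⟨.left⟩ ⊞ pres.diag.obj ⟨.right⟩ :=
      pres.isLimit.conePointsIsoOfNatIso
        (BinaryBiproduct.isLimit _ _) (diagramIsoPair pres.diag)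
    exact ⟨U ⊞ V, ⟨F.mapBiprod U V ≪≫ biprod.mapIso e e' ≪≫ i₁.symm⟩⟩

omit [Abelian A] [Preadditive M] in
theorem isStableUnderRetracts_essImage [IsIdempotentComplete M] [F.Full] [F.Faithful] :
    F.essImage.IsStableUnderRetracts where
  of_retract := by
    rintro X Y r ⟨U, ⟨e⟩⟩
    obtain ⟨f, hf⟩ := F.map_surjective (e.hom ≫ r.r ≫ r.i ≫ e.inv)
    have hff : f ≫ f = f := F.map_injective (by simp [hf])
    obtain ⟨V, i, p, hip, hpi⟩ := IsIdempotentComplete.idempotents_split U f hff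
    refine ⟨V, ⟨⟨F.map i ≫ e.hom ≫ r.r, r.i ≫ e.inv ≫ F.map p, ?_, ?_⟩⟩⟩
    · have : F.map i ≫ (e.hom ≫ r.r ≫ r.i ≫ e.inv) ≫ F.map p = 𝟙 _ := by
        rw [← hf, ← hpi, ← F.map_comp, ← F.map_comp, Category.assoc, hip, Category.comp_id, hip,
          F.map_id]
      simpa using this
    · have : F.map p ≫ F.map i = e.hom ≫ r.r ≫ r.i ≫ e.inv := by rw [← F.map_comp, hpi, hf]
      simp [reassoc_of% this]

/-! ### Transport along equalities of arrows -/

omit [Preadditive M] in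
/-- The first or last morphism of an `n`-cokernel or an `n`-kernel is prescribed only up to an
equality of arrows, which identifies the endpoints as well. -/
theorem arrow_prop_of_eq (R : ∀ ⦃X Y : M⦄, (X ⟶ Y) → Prop) {X Y X' Y' : M} {f : X ⟶ Y}
    {g : X' ⟶ Y'} (h : Arrow.mk g = Arrow.mk f) (hf : R f) : R g := by
  cases h
  exact hf

/-! ### Resolutions and coresolutions from `n`-kernels and `n`-cokernels -/

namespace Sequence

variable {S : Sequence M} {n : ℕ}

theorem IsNKernel.comp_eq_zero (hS : S.IsNKernel n) {k : ℕ} (hk : k < n) :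
    S.d k ≫ S.d (k + 1) = 0 :=
  (hS.1 k hk).1

/-- The short exact sequence `0 ⟶ coker F(d k) ⟶ F(X (k + 2)) ⟶ coker F(d (k + 1)) ⟶ 0`. -/
theorem IsNKernel.shortExact [F.Additive] (hF : IsPresentingFunctor F) (hS : S.IsNKernel n)
    {k : ℕ} (hk : k < n) :
    ∃ (i : cokernel (F.map (S.d k)) ⟶ F.obj (S.X (k + 2)))
      (w : i ≫ cokernel.π (F.map (S.d (k + 1))) = 0),
      cokernel.π (F.map (S.d k)) ≫ i = F.map (S.d (k + 1)) ∧
      (ShortComplex.mk i (cokernel.π (F.map (S.d (k + 1)))) w).ShortExact := by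
  have w := map_comp_eq_zero (F := F) (hS.comp_eq_zero hk)
  exact ⟨_, _, cokernel.π_desc _ _ _, shortExact_cokernel_of_exact _ _ w
    (hF.exact_of_isWeakKernel _ _ (hS.1 k hk) w)⟩

/-- The objects `X 0, …, X (k + 1)` resolve `coker F(d k)`. -/
theorem IsNKernel.hasResolution [F.Additive] (hF : IsPresentingFunctor F) (hS : S.IsNKernel n)
    {k : ℕ} (hk : k ≤ n) : HasResolution F.essImage (k + 1) (cokernel (F.map (S.d k))) := by
  induction k with
  | zero =>
    have := hS.2
    have := hF.mono_map (S.d 0)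
    exact ⟨_, _, F.map (S.d 0), cokernel.π _, cokernel.condition _,
      { exact := ShortComplex.exact_cokernel _ }, F.obj_mem_essImage _, F.obj_mem_essImage _⟩
  | succ k ih =>
    obtain ⟨i, w, -, h⟩ := hS.shortExact hF (k := k) (by lia)
    exact ⟨_, _, i, _, w, h, ih (by lia), F.obj_mem_essImage _⟩

/-- The objects `X (k + 2), …, X (n + 1)` form a coresolution of `coker F(d k)`. -/
theorem IsNExact.hasCoresolution [F.Additive] (hF : IsPresentingFunctor F) (hS : S.IsNExact n)
    {s k : ℕ} (hk : k + s = n) : HasCoresolution F.essImage s (cokernel (F.map (S.d k))) := by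
  induction s generalizing k with
  | zero =>
    obtain rfl : k = n := hk
    have := hF.epi_map _ hS.2.2
    exact isZero_cokernel_of_epi _
  | succ s ih =>
    obtain ⟨i, w, -, h⟩ := hS.1.shortExact hF (k := k) (by lia)
    exact ⟨_, _, i, _, w, h, F.obj_mem_essImage _, ih (by lia)⟩

/-- A morphism `coker F(d k) ⟶ F Y` corresponds to a morphism `X (k + 1) ⟶ Y` which vanishes on
`X k`; it extends because `d (k + 1)` is a weak cokernel of `d k`. -/
theorem IsNCokernel.exists_extension [F.Additive] [F.Full] [F.Faithful]
    (hS : S.IsNCokernel n) {k : ℕ} (hk : k < n)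
    {i : cokernel (F.map (S.d k)) ⟶ F.obj (S.X (k + 2))}
    (hi : cokernel.π (F.map (S.d k)) ≫ i = F.map (S.d (k + 1))) {Y : M}
    (f : cokernel (F.map (S.d k)) ⟶ F.obj Y) : ∃ g : F.obj (S.X (k + 2)) ⟶ F.obj Y, i ≫ g = f := by
  obtain ⟨h, hh⟩ := F.map_surjective (cokernel.π (F.map (S.d k)) ≫ f)
  obtain ⟨g, rfl⟩ := (hS.1 k hk).2 h (F.map_injective (by simp [hh]))
  refine ⟨F.map g, ?_⟩
  rw [← cancel_epi (cokernel.π (F.map (S.d k))), reassoc_of% hi, ← hh, F.map_comp]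

/-- Vanishing of `Ext^l` on the essential image for `l ≤ j` passes to the cokernels in an `n`-exact
sequence: dimension shifting goes down to `Ext^1`, where the extension property applies. -/
theorem IsNExact.extVanishes_cokernel [F.Additive] [F.Full] [F.Faithful]
    (hF : IsPresentingFunctor F) (hS : S.IsNExact n) {Y : M} {j : ℕ}
    (hj : ∀ l, 1 ≤ l → l ≤ j → ∀ X : M, ExtVanishes (F.obj X) (F.obj Y) l) {l k : ℕ} (hl : 1 ≤ l)
    (hlj : l ≤ j) (hlk : l ≤ k) (hk : k ≤ n) :
    ExtVanishes (cokernel (F.map (S.d k))) (F.obj Y) l := by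
  induction l, hl using Nat.le_induction generalizing k with
  | base =>
    obtain ⟨k, rfl⟩ := Nat.exists_eq_add_of_le' hlk
    obtain ⟨i, w, hi, h⟩ := hS.1.shortExact hF (k := k) (by lia)
    exact .right_one_of_extension h (hS.2.exists_extension (by lia) hi) (hj 1 le_rfl hlj _)
  | succ l hl ih =>
    obtain ⟨k, rfl⟩ := Nat.exists_eq_add_of_le' (show 1 ≤ k by lia)
    obtain ⟨i, w, hi, h⟩ := hS.1.shortExact hF (k := k) (by lia)
    exact .right_of_shortExact h (ih (by lia) (by lia) (by lia)) (hj _ (by lia) hlj _)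

end Sequence

namespace IsPresentingFunctor

variable {n : ℕ}

/-- If `X n` is projective in an `n`-exact sequence, then dimension shifting along the sequence
reduces `Ext^k(F(X (n + 1)), F Y)` to an extension property of weak cokernels. -/
theorem extVanishes [HasFiniteBiproducts M] [EnoughProjectives M] [F.Additive] [F.Full]
    [F.Faithful] (hF : IsPresentingFunctor F) (hM : IsNAbelian M n) {k : ℕ} (hk : 1 ≤ k)
    (hkn : k < n) (X Y : M) : ExtVanishes (F.obj X) (F.obj Y) k := by
  induction k using Nat.strong_induction_on generalizing X with
  | _ k ih =>
  obtain ⟨S, hSX, hS⟩ := hM.exists_nKernel (Projective.π X)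
  -- `1 ≤ k < n` forces `2 ≤ n`
  obtain ⟨m, rfl⟩ : ∃ m, n = m + 2 := ⟨n - 2, by lia⟩
  have hepi : Epi (S.d (m + 2)) :=
    arrow_prop_of_eq (fun _ _ f => Epi f) hSX (Projective.π_epi X)
  have hproj : Projective (S.X (m + 2)) :=
    arrow_prop_of_eq (fun X _ _ => Projective X) hSX (Projective.projective_over X)
  have hproj' := hF.projective_obj _ hproj
  obtain rfl : S.X (m + 2 + 1) = X := congrArg (fun f : Arrow M => f.right) hSX
  have hS' := hM.nExact_of_epi S hepi hS
  have w := map_comp_eq_zero (F := F) (hS.comp_eq_zero (k := m + 1) (by lia))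
  have := hF.epi_map _ hepi
  have hex := hF.exact_of_isWeakKernel _ _ (hS.1 (m + 1) (by lia)) w
  have hmono := hex.mono_cokernelDesc
  dsimp at hmono
  have hepi' : Epi (cokernel.desc (F.map (S.d (m + 1))) (F.map (S.d (m + 1 + 1))) w) := by
    have : Epi (cokernel.π (F.map (S.d (m + 1))) ≫
      cokernel.desc (F.map (S.d (m + 1))) (F.map (S.d (m + 1 + 1))) w) := by
      rw [cokernel.π_desc]; assumption
    exact epi_of_epi (cokernel.π (F.map (S.d (m + 1)))) _
  have : IsIso (cokernel.desc (F.map (S.d (m + 1))) (F.map (S.d (m + 1 + 1))) w) :=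
    isIso_of_mono_of_epi _
  -- `F X` is the cokernel of `F(d (n - 1))`, to which dimension shifting applies
  refine ExtVanishes.of_iso ?_
    (asIso (cokernel.desc (F.map (S.d (m + 1))) (F.map (S.d (m + 1 + 1))) w)) (Iso.refl _)
  obtain ⟨i, w, hi, h⟩ := hS.shortExact hF (k := m) (by lia)
  obtain ⟨k, rfl⟩ := Nat.exists_eq_add_of_le' hk
  cases k with
  | zero =>
    exact .right_one_of_extension h (hS'.2.exists_extension (by lia) hi)
      (.of_projective _ _ le_rfl)
  | succ k =>
    refine .right_of_shortExact h ?_ (.of_projective _ _ (by lia))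
    exact hS'.extVanishes_cokernel hF (j := k + 1)
      (fun l hl hlk X => ih l (by lia) hl (by lia) X) (by lia) le_rfl (by lia) (by lia)

theorem extVanishes_essImage [HasFiniteBiproducts M] [EnoughProjectives M] [F.Additive] [F.Full]
    [F.Faithful] (hF : IsPresentingFunctor F) (hM : IsNAbelian M n) {k : ℕ} (hk : 1 ≤ k)
    (hkn : k < n) {X Y : A} (hX : F.essImage X) (hY : F.essImage Y) : ExtVanishes X Y k := by
  obtain ⟨U, ⟨e⟩⟩ := hX
  obtain ⟨V, ⟨e'⟩⟩ := hY
  exact (hF.extVanishes hM hk hkn U V).of_iso e e'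

/-- The quotient of a monomorphism between objects of the essential image is coresolved by an
`n`-cokernel of that monomorphism, since the two form an `n`-exact sequence. -/
theorem hasCoresolution [HasFiniteBiproducts M] [F.Additive] [F.Full]
    [F.Faithful] (hF : IsPresentingFunctor F) (hM : IsNAbelian M n) ⦃N₁ N₀ X : A⦄ (i : N₁ ⟶ N₀)
    (p : N₀ ⟶ X) (w : i ≫ p = 0) (h : (ShortComplex.mk i p w).ShortExact)
    (hN₁ : F.essImage N₁) (hN₀ : F.essImage N₀) : HasCoresolution F.essImage n X := by
  obtain ⟨U, ⟨e⟩⟩ := hN₁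
  obtain ⟨V, ⟨e'⟩⟩ := hN₀
  obtain ⟨f, hf⟩ := F.map_surjective (e.hom ≫ i ≫ e'.inv)
  have hi := h.mono_f
  have hp := h.epi_g
  dsimp at hi hp
  have hFf : Mono (F.map f) := by rw [hf]; infer_instance
  have hf' : Mono f := F.mono_of_mono_map hFf
  obtain ⟨S, hSf, hS⟩ := hM.exists_nCokernel f
  have hS' := hM.nExact_of_mono S
    (arrow_prop_of_eq (fun _ _ f => Mono f) hSf hf') hS
  have hcok := hS'.hasCoresolution hF (zero_add n)
  have e₁ : cokernel (F.map f) ≅ X :=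
    cokernel.mapIso (F.map f) i e e' (by simp [hf]) ≪≫
      IsColimit.coconePointUniqueUpToIso (cokernelIsCokernel i) h.gIsCokernel
  have hcok' : HasCoresolution F.essImage n (cokernel (F.map f)) :=
    arrow_prop_of_eq (fun _ _ g => HasCoresolution F.essImage n (cokernel (F.map g))) hSf.symm hcok
  exact hcok'.of_iso e₁

/-- A presentation of `X` by a morphism `f` of `M`, together with an `n`-kernel of `f`, is a
resolution of `X`; it is longer by two than the resolutions which exist in the end. -/
theorem hasResolution [HasFiniteBiproducts M] [F.Additive]
    (hF : IsPresentingFunctor F) (hM : IsNAbelian M n) (X : A) :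
    HasResolution F.essImage (n + 1) X := by
  obtain ⟨U, V, f, p, w, hex, hp⟩ := hF.exists_presentation X
  obtain ⟨S, hSf, hS⟩ := hM.exists_nKernel f
  have hcok := hS.hasResolution hF le_rfl
  have hcok' : HasResolution F.essImage (n + 1) (cokernel (F.map f)) :=
    arrow_prop_of_eq (fun _ _ g => HasResolution F.essImage (n + 1) (cokernel (F.map g)))
      hSf.symm hcok
  exact hcok'.of_iso
    (IsColimit.coconePointUniqueUpToIso (cokernelIsCokernel (F.map f)) hex.gIsCokernel)

/-- If `X` is the cokernel of `F f` and `g` is a weak cokernel of `f`, then the morphism from `X`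
induced by `g` is a left approximation. -/
theorem isCovariantlyFinite [HasFiniteBiproducts M] [F.Additive] [F.Full] [F.Faithful]
    (hF : IsPresentingFunctor F) (hM : IsNAbelian M n) (hn : 1 ≤ n) :
    IsCovariantlyFinite F.essImage := by
  intro X
  obtain ⟨U, V, f, p, w, hex, hp⟩ := hF.exists_presentation X
  obtain ⟨W, g, hg⟩ : ∃ (W : M) (g : V ⟶ W), IsWeakCokernel f g := by
    obtain ⟨S, hSf, hS⟩ := hM.exists_nCokernel f
    exact arrow_prop_of_eq (fun _ Y f => ∃ (W : M) (g : Y ⟶ W), IsWeakCokernel f g) hSf.symm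
      ⟨_, _, hS.1 0 hn⟩
  have w' := map_comp_eq_zero (F := F) hg.1
  have hdesc : p ≫ hex.desc (F.map g) w' = F.map g := hex.g_desc _ _
  refine ⟨F.obj W, hex.desc (F.map g) w', F.obj_mem_essImage W, ?_⟩
  rintro Z ⟨Y, ⟨e⟩⟩ h
  obtain ⟨k, hk⟩ := F.map_surjective (p ≫ h ≫ e.inv)
  obtain ⟨q, rfl⟩ := hg.2 k (F.map_injective (by simp [hk, reassoc_of% w]))
  refine ⟨F.map q ≫ e.hom, ?_⟩
  rw [← cancel_epi p, ← Category.assoc, hdesc, ← Category.assoc, ← F.map_comp, hk]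
  simp

/-- An injective object `I` has `Ext^k(-, I) = 0`, hence lies in the essential image by the second
equality below. So the essential image is cogenerating as soon as there are enough injectives. -/
theorem essImage_properties [HasFiniteBiproducts M] [EnoughProjectives M] [F.Additive] [F.Full]
    [F.Faithful] (hF : IsPresentingFunctor F) (hM : IsNAbelian M n) (hn : 1 ≤ n) :
    F.essImage = leftExtPerp n F.essImage ∧ F.essImage = rightExtPerp n F.essImage ∧
      IsContravariantlyFinite F.essImage ∧
      (EnoughInjectives A → IsNClusterTilting n F.essImage) := by
  have := hM.idempotentComplete
  have := isClosedUnderBinaryProducts_essImage (F := F)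
  have := isStableUnderRetracts_essImage (F := F)
  obtain ⟨n, rfl⟩ := Nat.exists_eq_add_of_le' hn
  have hl : ∀ X, F.essImage X → leftExtPerp (n + 1) F.essImage X :=
    fun X hX k hk hkn Y hY => hF.extVanishes_essImage hM hk hkn hX hY
  have hr : ∀ X, F.essImage X → rightExtPerp (n + 1) F.essImage X :=
    fun X hX k hk hkn Y hY => hF.extVanishes_essImage hM hk hkn hY hX
  have hres := hasResolution_of_forall_hasResolution hr (hF.hasCoresolution hM)
    (hF.hasResolution hM)
  have eql := eq_leftExtPerp_of_hasResolution hl hres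
  have eqr := eq_rightExtPerp_of_hasResolution hl hr (hF.hasCoresolution hM) hres
  have hcf := isContravariantlyFinite_of_hasResolution hl hres
  refine ⟨eql, eqr, hcf, fun hI => ⟨?_, ?_, hF.isCovariantlyFinite hM hn, hcf, eql, eqr⟩⟩
  · intro X
    obtain ⟨U, V, f, p, w, hex, hp⟩ := hF.exists_presentation X
    exact ⟨F.obj V, p, F.obj_mem_essImage V, hp⟩
  · intro X
    refine ⟨Injective.under X, Injective.ι X, ?_, inferInstance⟩
    rw [eqr]
    exact fun k hk _ Y _ => .of_injective _ _ hk

end IsPresentingFunctor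

end Embedding

/-! ### Exactness and representable functors in functor categories -/

section FunctorCategory

open Opposite

theorem exact_of_forall_exact_app {J : Type u} [Category.{v} J] {D : Type*} [Category* D]
    [Abelian D] {S : ShortComplex (J ⥤ D)}
    (h : ∀ j, (S.map ((evaluation J D).obj j)).Exact) : S.Exact := by
  rw [ShortComplex.exact_iff_isZero_homology, IsZero.iff_id_eq_zero]
  ext j
  exact (IsZero.of_iso ((ShortComplex.exact_iff_isZero_homology _).1 (h j))
    (S.mapHomologyIso ((evaluation J D).obj j)).symm).eq_of_src _ _

variable {C : Type u} [Category.{v} C]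

/-- In an exact sequence of functors to abelian groups, elements which are mapped to zero lift. -/
theorem exists_app_eq_of_exact {F G H : Cᵒᵖ ⥤ AddCommGrpCat.{v}} {f : F ⟶ G} {g : G ⟶ H}
    {w : f ≫ g = 0} (h : (ShortComplex.mk f g w).Exact) {X : Cᵒᵖ} (x : G.obj X)
    (hx : g.app X x = 0) : ∃ y : F.obj X, f.app X y = x :=
  (ShortComplex.ab_exact_iff _).1 (h.map ((evaluation _ _).obj X)) x hx

theorem exact_of_forall_exists_app_eq {F G H : Cᵒᵖ ⥤ AddCommGrpCat.{v}} {f : F ⟶ G} {g : G ⟶ H}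
    {w : f ≫ g = 0} (h : ∀ (X : Cᵒᵖ) (x : G.obj X), g.app X x = 0 → ∃ y : F.obj X, f.app X y = x) :
    (ShortComplex.mk f g w).Exact :=
  exact_of_forall_exact_app fun X => (ShortComplex.ab_exact_iff _).2 fun x hx => h X x hx

variable [Preadditive C]

instance : (preadditiveYoneda : C ⥤ Cᵒᵖ ⥤ AddCommGrpCat.{v}).Additive where
  map_add := by
    intro X Y f g
    ext Z u
    exact Preadditive.comp_add _ _ _ u f g

/-- The natural transformation from a representable functor given by an element of an additive
functor. -/
def yonedaHom (G : Cᵒᵖ ⥤ AddCommGrpCat.{v}) [G.Additive] {X : C} (x : G.obj (op X)) :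
    preadditiveYoneda.obj X ⟶ G where
  app Z := AddCommGrpCat.ofHom (AddMonoidHom.mk' (fun u : Z.unop ⟶ X => G.map u.op x)
    fun (u v : Z.unop ⟶ X) => ConcreteCategory.congr_hom (G.map_add (f := u.op) (g := v.op)) x)
  naturality Z Z' h := by
    refine AddCommGrpCat.ext fun (u : Z.unop ⟶ X) => ?_
    change G.map (h.unop ≫ u).op x = G.map h (G.map u.op x)
    rw [op_comp, G.map_comp]; rfl

theorem yonedaHom_app_id (G : Cᵒᵖ ⥤ AddCommGrpCat.{v}) [G.Additive] {X : C} (x : G.obj (op X)) :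
    (yonedaHom G x).app (op X) (𝟙 X) = x := by
  change G.map (𝟙 X).op x = x
  rw [op_id, G.map_id]; rfl

theorem preadditiveYoneda_hom_ext {G : Cᵒᵖ ⥤ AddCommGrpCat.{v}} {X : C}
    {φ ψ : preadditiveYoneda.obj X ⟶ G}
    (h : φ.app (op X) (𝟙 X) = ψ.app (op X) (𝟙 X)) : φ = ψ := by
  refine NatTrans.ext (funext fun Z => AddCommGrpCat.ext fun (u : Z.unop ⟶ X) => ?_)
  have key : ∀ χ : preadditiveYoneda.obj X ⟶ G,
      χ.app Z u = G.map u.op (χ.app (op X) (𝟙 X)) := fun χ =>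
    (congrArg (χ.app Z) (Category.comp_id u).symm).trans
      (ConcreteCategory.congr_hom (χ.naturality u.op) (𝟙 X))
  exact (key φ).trans ((congrArg _ h).trans (key ψ).symm)

/-- Representable functors are projective relative to additive functors. -/
theorem exists_lift_of_exact {F G H : Cᵒᵖ ⥤ AddCommGrpCat.{v}} [F.Additive] {f : F ⟶ G}
    {g : G ⟶ H} {w : f ≫ g = 0} (h : (ShortComplex.mk f g w).Exact) {X : C}
    (φ : preadditiveYoneda.obj X ⟶ G) (hφ : φ ≫ g = 0) :
    ∃ ψ : preadditiveYoneda.obj X ⟶ F, ψ ≫ f = φ := by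
  obtain ⟨y, hy⟩ := exists_app_eq_of_exact h (φ.app (op X) (𝟙 X))
    (ConcreteCategory.congr_hom (NatTrans.congr_app hφ (op X)) (𝟙 X))
  refine ⟨yonedaHom F y, preadditiveYoneda_hom_ext ?_⟩
  rw [← hy]
  exact congrArg _ (yonedaHom_app_id F y)

theorem exists_lift_of_epi {F G : Cᵒᵖ ⥤ AddCommGrpCat.{v}} [F.Additive] (f : F ⟶ G) [Epi f] {X : C}
    (φ : preadditiveYoneda.obj X ⟶ G) : ∃ ψ : preadditiveYoneda.obj X ⟶ F, ψ ≫ f = φ :=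
  exists_lift_of_exact (w := cokernel.condition f) (ShortComplex.exact_cokernel f) φ
    (by rw [cokernel.π_of_epi, comp_zero])

theorem additive_of_isCoherent {G : Cᵒᵖ ⥤ AddCommGrpCat.{v}} (hG : isCoherent C G) :
    G.Additive := by
  obtain ⟨X, Y, f, p, w, -, hp⟩ := hG
  refine ⟨fun {U V u v} => ?_⟩
  rw [← cancel_epi (p.app U), ← p.naturality, Functor.map_add, Preadditive.add_comp,
    Preadditive.comp_add, p.naturality, p.naturality]

theorem exact_preadditiveYoneda_map {X Y Z : C} {f : X ⟶ Y} {g : Y ⟶ Z} (h : IsWeakKernel f g)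
    (w : preadditiveYoneda.map f ≫ preadditiveYoneda.map g = 0) :
    (ShortComplex.mk (preadditiveYoneda.map f) (preadditiveYoneda.map g) w).Exact := by
  refine exact_of_forall_exists_app_eq fun U (x : U.unop ⟶ Y) (hx : x ≫ g = 0) => ?_
  obtain ⟨p, rfl⟩ := h.2 x hx
  exact ⟨p, rfl⟩

end FunctorCategory

/-! ### Coherent functors form an abelian category -/

section Coherent

open ZeroObject

variable {C : Type u} [Category.{v} C] [Preadditive C] [HasFiniteBiproducts C]

/-- A weak kernel of `(a, -b) : A ⊞ B ⟶ Z` is a weak pullback of `a` and `b`; it becomes a pullback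
up to epimorphisms among functors. -/
theorem exists_weakPullback
    (hC : ∀ ⦃X Y : C⦄ (f : X ⟶ Y), ∃ (W : C) (k : W ⟶ X), IsWeakKernel k f)
    {A B Z : C} (a : A ⟶ Z) (b : B ⟶ Z) :
    ∃ (W : C) (p : W ⟶ A) (q : W ⟶ B), p ≫ a = q ≫ b ∧
      ∀ ⦃T : Cᵒᵖ ⥤ AddCommGrpCat.{v}⦄ (s : T ⟶ preadditiveYoneda.obj A)
        (r : T ⟶ preadditiveYoneda.obj B),
        s ≫ preadditiveYoneda.map a = r ≫ preadditiveYoneda.map b →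
        ∃ (T' : Cᵒᵖ ⥤ AddCommGrpCat.{v}) (π : T' ⟶ T) (_ : Epi π)
          (t : T' ⟶ preadditiveYoneda.obj W), π ≫ s = t ≫ preadditiveYoneda.map p := by
  have := hasBinaryBiproducts_of_finite_biproducts C
  obtain ⟨W, k, hk⟩ := hC (biprod.desc a (-b))
  refine ⟨W, k ≫ biprod.fst, k ≫ biprod.snd, ?_, fun T s r h => ?_⟩
  · have h := hk.1
    have e : k = biprod.lift (k ≫ biprod.fst) (k ≫ biprod.snd) := by ext <;> simp
    rw [e, biprod.lift_desc, Preadditive.comp_neg, ← sub_eq_add_neg, sub_eq_zero] at h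
    exact h
  · have hex := exact_preadditiveYoneda_map hk
      (by rw [← Functor.map_comp, hk.1, Functor.map_zero])
    obtain ⟨T', π, hπ, t, ht⟩ := hex.exact_up_to_refinements
      (s ≫ preadditiveYoneda.map biprod.inl + r ≫ preadditiveYoneda.map biprod.inr) (by
        dsimp
        rw [Preadditive.add_comp, Category.assoc, Category.assoc, ← Functor.map_comp,
          ← Functor.map_comp, biprod.inl_desc, biprod.inr_desc, h, Functor.map_neg,
          Preadditive.comp_neg, add_neg_cancel])
    dsimp at t ht
    refine ⟨T', π, hπ, t, ?_⟩
    rw [Functor.map_comp, ← Category.assoc, ← ht, Category.assoc, Preadditive.add_comp,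
      Category.assoc, Category.assoc, ← Functor.map_comp, ← Functor.map_comp, biprod.inl_fst,
      biprod.inr_fst, CategoryTheory.Functor.map_id, Functor.map_zero, comp_zero, add_zero,
      Category.comp_id]

/-- If `X₁ ⟶ Y₁` and `X₂ ⟶ Y₂` present the source and the target of `φ`, then
`X₂ ⊞ Y₁ ⟶ Y₂` presents the cokernel of `φ`. -/
theorem isClosedUnderCokernels_isCoherent : (isCoherent C).IsClosedUnderCokernels where
  cokernels_le := by
    intro _ ⟨φ, c, hc, hG, hH⟩
    have := hasBinaryBiproducts_of_finite_biproducts C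
    obtain ⟨X₁, Y₁, f₁, p₁, w₁, h₁, _⟩ := hG
    obtain ⟨X₂, Y₂, f₂, p₂, w₂, h₂, _⟩ := hH
    obtain ⟨ψ, hψ⟩ := exists_lift_of_epi p₂ (p₁ ≫ φ)
    obtain ⟨a, rfl⟩ := preadditiveYoneda.map_surjective ψ
    have : Epi c.π := Cofork.IsColimit.epi hc
    refine ⟨X₂ ⊞ Y₁, Y₂, biprod.desc f₂ a, p₂ ≫ c.π, ?_, ?_, inferInstance⟩
    · have e : biprod.desc f₂ a = biprod.fst ≫ f₂ + biprod.snd ≫ a := by ext <;> simp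
      rw [e, Functor.map_add, Functor.map_comp, Functor.map_comp, Preadditive.add_comp,
        Category.assoc, Category.assoc, reassoc_of% w₂, reassoc_of% hψ,
        CokernelCofork.condition]
      simp
    · rw [ShortComplex.exact_iff_exact_up_to_refinements]
      intro T t ht
      dsimp at t ht
      obtain ⟨T₁, π₁, _, s, hs⟩ :=
        (CokernelCofork.IsColimit.comp_π_eq_zero_iff_up_to_refinements hc (t ≫ p₂)).1
          (by rw [Category.assoc, ht])
      obtain ⟨T₂, π₂, _, r, hr⟩ := surjective_up_to_refinements_of_epi p₁ s
      obtain ⟨T₃, π₃, _, x, hx⟩ := h₂.exact_up_to_refinements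
        (π₂ ≫ π₁ ≫ t - r ≫ preadditiveYoneda.map a) (by
          dsimp
          rw [Preadditive.sub_comp, Category.assoc, Category.assoc, Category.assoc, hs, hψ,
            reassoc_of% hr, sub_self])
      dsimp at x hx
      refine ⟨T₃, π₃ ≫ π₂ ≫ π₁, inferInstance, x ≫ preadditiveYoneda.map biprod.inl +
        π₃ ≫ r ≫ preadditiveYoneda.map biprod.inr, ?_⟩
      dsimp
      rw [Preadditive.add_comp, Category.assoc, Category.assoc, Category.assoc, Category.assoc,
        Category.assoc, ← Functor.map_comp, ← Functor.map_comp, biprod.inl_desc, biprod.inr_desc,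
        ← hx, Preadditive.comp_sub, sub_add_cancel]

/-- Weak pullbacks give a representable functor which maps onto the kernel of a morphism of coherent
functors, and a second one which maps onto the kernel of the resulting epimorphism. -/
theorem isClosedUnderKernels_isCoherent
    (hC : ∀ ⦃X Y : C⦄ (f : X ⟶ Y), ∃ (W : C) (k : W ⟶ X), IsWeakKernel k f) :
    (isCoherent C).IsClosedUnderKernels where
  kernels_le := by
    intro _ ⟨φ, c, hc, hG, hH⟩
    obtain ⟨X₁, Y₁, f₁, p₁, w₁, h₁, _⟩ := hG
    obtain ⟨X₂, Y₂, f₂, p₂, w₂, h₂, _⟩ := hH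
    obtain ⟨ψ, hψ⟩ := exists_lift_of_epi p₂ (p₁ ≫ φ)
    obtain ⟨a, rfl⟩ := preadditiveYoneda.map_surjective ψ
    have : Mono c.ι := Fork.IsLimit.mono hc
    obtain ⟨W, b, b', hb, hW⟩ := exists_weakPullback hC a f₂
    obtain ⟨V, k, k', hk, hV⟩ := exists_weakPullback hC b f₁
    obtain ⟨p, hp⟩ := KernelFork.IsLimit.lift' hc (preadditiveYoneda.map b ≫ p₁) (by
      rw [Category.assoc, ← hψ, ← Category.assoc, ← Functor.map_comp, hb, Functor.map_comp,
        Category.assoc, w₂, comp_zero])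
    refine ⟨V, W, k, p, ?_, ?_, ?_⟩
    · rw [← cancel_mono c.ι, Category.assoc, zero_comp]
      erw [hp]
      rw [← Category.assoc, ← Functor.map_comp, hk, Functor.map_comp, Category.assoc, w₁,
        comp_zero]
    · rw [ShortComplex.exact_iff_exact_up_to_refinements]
      intro T t ht
      dsimp at t ht
      obtain ⟨T₁, π₁, _, r, hr⟩ := h₁.exact_up_to_refinements (t ≫ preadditiveYoneda.map b) (by
        dsimp
        rw [Category.assoc, ← hp, ← Category.assoc]
        erw [ht]
        rw [zero_comp])
      dsimp at r hr
      obtain ⟨T₂, π₂, _, s, hs⟩ := hV (π₁ ≫ t) r (by rw [Category.assoc, hr])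
      exact ⟨T₂, π₂ ≫ π₁, inferInstance, s, by simpa using hs⟩
    · rw [epi_iff_surjective_up_to_refinements]
      intro T t
      obtain ⟨T₁, π₁, _, s, hs⟩ := surjective_up_to_refinements_of_epi p₁ (t ≫ c.ι)
      obtain ⟨T₂, π₂, _, r, hr⟩ := h₂.exact_up_to_refinements (s ≫ preadditiveYoneda.map a) (by
        dsimp
        rw [Category.assoc, hψ, ← reassoc_of% hs]
        erw [KernelFork.condition]
        simp)
      dsimp at r hr
      obtain ⟨T₃, π₃, _, x, hx⟩ := hW (π₂ ≫ s) r (by rw [Category.assoc, hr])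
      refine ⟨T₃, π₃ ≫ π₂ ≫ π₁, inferInstance, x, ?_⟩
      rw [← cancel_mono c.ι, Category.assoc x]
      erw [hp]
      rw [← reassoc_of% hx, Category.assoc, Category.assoc, Category.assoc, hs]

theorem containsZero_isCoherent : (isCoherent C).ContainsZero where
  exists_zero := by
    have h : IsZero ((preadditiveYoneda : C ⥤ Cᵒᵖ ⥤ AddCommGrpCat.{v}).obj 0) :=
      preadditiveYoneda.map_isZero (isZero_zero C)
    exact ⟨_, h, 0, 0, 0, 𝟙 _, h.eq_of_src _ _, ShortComplex.exact_of_isZero_X₂ _ h, inferInstance⟩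

omit [HasFiniteBiproducts C] in
theorem isClosedUnderIsomorphisms_isCoherent : (isCoherent C).IsClosedUnderIsomorphisms where
  of_iso := by
    rintro G H e ⟨X, Y, f, p, w, h, _⟩
    have w' : preadditiveYoneda.map f ≫ p ≫ e.hom = 0 := by rw [reassoc_of% w, zero_comp]
    have i : ShortComplex.mk _ _ w ≅ ShortComplex.mk _ _ w' :=
      ShortComplex.isoMk (Iso.refl _) (Iso.refl _) e
    exact ⟨X, Y, f, p ≫ e.hom, w', ShortComplex.exact_of_iso i h, inferInstance⟩

theorem isCoherent_biprod {G H : Cᵒᵖ ⥤ AddCommGrpCat.{v}} (hG : isCoherent C G)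
    (hH : isCoherent C H) : isCoherent C (G ⊞ H) := by
  have := hasBinaryBiproducts_of_finite_biproducts C
  obtain ⟨X₁, Y₁, f₁, p₁, w₁, h₁, _⟩ := hG
  obtain ⟨X₂, Y₂, f₂, p₂, w₂, h₂, _⟩ := hH
  refine ⟨X₁ ⊞ X₂, Y₁ ⊞ Y₂, biprod.map f₁ f₂, biprod.lift
    (preadditiveYoneda.map biprod.fst ≫ p₁) (preadditiveYoneda.map biprod.snd ≫ p₂), ?_, ?_, ?_⟩
  · refine biprod.hom_ext _ _ ?_ ?_
    · rw [Category.assoc, biprod.lift_fst, ← Category.assoc, ← Functor.map_comp, biprod.map_fst,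
        Functor.map_comp, Category.assoc, w₁, comp_zero, zero_comp]
    · rw [Category.assoc, biprod.lift_snd, ← Category.assoc, ← Functor.map_comp, biprod.map_snd,
        Functor.map_comp, Category.assoc, w₂, comp_zero, zero_comp]
  · rw [ShortComplex.exact_iff_exact_up_to_refinements]
    intro T t ht
    dsimp only at t ht
    have ht₁ : (t ≫ preadditiveYoneda.map biprod.fst) ≫ p₁ = 0 := by
      rw [Category.assoc, ← biprod.lift_fst (preadditiveYoneda.map biprod.fst ≫ p₁)
        (preadditiveYoneda.map biprod.snd ≫ p₂), ← Category.assoc, ht, zero_comp]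
    have ht₂ : (t ≫ preadditiveYoneda.map biprod.snd) ≫ p₂ = 0 := by
      rw [Category.assoc, ← biprod.lift_snd (preadditiveYoneda.map biprod.fst ≫ p₁)
        (preadditiveYoneda.map biprod.snd ≫ p₂), ← Category.assoc, ht, zero_comp]
    obtain ⟨T₁, π₁, _, r₁, hr₁⟩ := h₁.exact_up_to_refinements _ ht₁
    obtain ⟨T₂, π₂, _, r₂, hr₂⟩ := h₂.exact_up_to_refinements
      (π₁ ≫ t ≫ preadditiveYoneda.map biprod.snd) (by
        dsimp only
        rw [Category.assoc, ht₂, comp_zero])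
    dsimp only at r₁ hr₁ r₂ hr₂
    refine ⟨T₂, π₂ ≫ π₁, inferInstance, π₂ ≫ r₁ ≫ preadditiveYoneda.map biprod.inl +
      r₂ ≫ preadditiveYoneda.map biprod.inr, ?_⟩
    dsimp only
    rw [Preadditive.add_comp, Category.assoc, Category.assoc, Category.assoc, Category.assoc,
      ← Functor.map_comp, ← Functor.map_comp, biprod.inl_map, biprod.inr_map, Functor.map_comp,
      Functor.map_comp, ← reassoc_of% hr₁, ← reassoc_of% hr₂, ← Functor.map_comp,
      ← Functor.map_comp, ← Preadditive.comp_add, ← Preadditive.comp_add, ← Preadditive.comp_add,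
      ← Functor.map_add, biprod.total, CategoryTheory.Functor.map_id, Category.comp_id]
  · rw [epi_iff_surjective_up_to_refinements]
    intro T t
    obtain ⟨T₁, π₁, _, s₁, hs₁⟩ := surjective_up_to_refinements_of_epi p₁ (t ≫ biprod.fst)
    obtain ⟨T₂, π₂, _, s₂, hs₂⟩ := surjective_up_to_refinements_of_epi p₂ (π₁ ≫ t ≫ biprod.snd)
    refine ⟨T₂, π₂ ≫ π₁, inferInstance, π₂ ≫ s₁ ≫ preadditiveYoneda.map biprod.inl +
      s₂ ≫ preadditiveYoneda.map biprod.inr, ?_⟩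
    refine biprod.hom_ext _ _ ?_ ?_
    · rw [Category.assoc, Category.assoc, Category.assoc, biprod.lift_fst, Preadditive.add_comp]
      simp only [Category.assoc]
      rw [← Functor.map_comp_assoc, ← Functor.map_comp_assoc, biprod.inl_fst, biprod.inr_fst,
        CategoryTheory.Functor.map_id, Functor.map_zero, Category.id_comp, zero_comp, comp_zero,
        add_zero, hs₁]
    · rw [Category.assoc, Category.assoc, Category.assoc, biprod.lift_snd, Preadditive.add_comp]
      simp only [Category.assoc]
      rw [← Functor.map_comp_assoc, ← Functor.map_comp_assoc, biprod.inl_snd, biprod.inr_snd,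
        CategoryTheory.Functor.map_id, Functor.map_zero, Category.id_comp, zero_comp, comp_zero,
        comp_zero, zero_add, hs₂]

theorem isClosedUnderFiniteProducts_isCoherent : (isCoherent C).IsClosedUnderFiniteProducts := by
  have := isClosedUnderIsomorphisms_isCoherent (C := C)
  have := containsZero_isCoherent (C := C)
  have : (isCoherent C).IsClosedUnderBinaryProducts :=
    { limitsOfShape_le := by
        rintro G ⟨pres⟩
        have i : G ≅ pres.diag.obj ⟨.left⟩ ⊞ pres.diag.obj ⟨.right⟩ :=
          pres.isLimit.conePointsIsoOfNatIso
            (BinaryBiproduct.isLimit _ _) (diagramIsoPair pres.diag)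
        exact (isCoherent C).prop_of_iso i.symm
          (isCoherent_biprod (pres.prop_diag_obj _) (pres.prop_diag_obj _)) }
  exact .mk'

end Coherent

/-! ### The category of projective objects -/

section Projectives

open Opposite

variable {M : Type u} [Category.{v} M] [Preadditive M]

theorem hasFiniteBiproducts_proj [HasFiniteBiproducts M] : HasFiniteBiproducts (Proj M) := by
  have := hasBinaryBiproducts_of_finite_biproducts M
  have : (isProjective M).IsClosedUnderIsomorphisms :=
    ⟨fun e (h : Projective _) => Projective.of_iso e h⟩
  have : (isProjective M).IsClosedUnderLimitsOfShape (Discrete.{0} PEmpty) :=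
    have : (isProjective M).ContainsZero := ⟨_, isZero_zero M, Projective.zero_projective⟩
    inferInstance
  have : (isProjective M).IsClosedUnderBinaryProducts :=
    { limitsOfShape_le := by
        rintro X ⟨pres⟩
        have i : X ≅ pres.diag.obj ⟨.left⟩ ⊞ pres.diag.obj ⟨.right⟩ :=
          pres.isLimit.conePointsIsoOfNatIso
            (BinaryBiproduct.isLimit _ _) (diagramIsoPair pres.diag)
        have h₁ : Projective (pres.diag.obj ⟨.left⟩) := pres.prop_diag_obj _
        have h₂ : Projective (pres.diag.obj ⟨.right⟩) := pres.prop_diag_obj _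
        exact Projective.of_iso i.symm inferInstance }
  have : (isProjective M).IsClosedUnderFiniteProducts := .mk'
  have : HasFiniteProducts (Proj M) := inferInstance
  exact HasFiniteBiproducts.of_hasFiniteProducts

/-- On the category of projective objects, the functor represented by `P` in `M` is the functor
represented by `P`. -/
noncomputable def projYonedaIso (P : Proj M) :
    preadditiveYoneda.obj P ≅ (restrictedYoneda M).obj P.obj :=
  have : IsIso (preadditiveYonedaMap (isProjective M).ι P) := by
    rw [NatTrans.isIso_iff_isIso_app]
    intro Q
    rw [ConcreteCategory.isIso_iff_bijective]
    exact ⟨fun f g h => (isProjective M).ι.map_injective h,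
      fun f => (isProjective M).ι.map_surjective f⟩
  asIso (preadditiveYonedaMap (isProjective M).ι P)

theorem projYonedaIso_naturality {P Q : Proj M} (f : P ⟶ Q) :
    preadditiveYoneda.map f ≫ (projYonedaIso Q).hom =
      (projYonedaIso P).hom ≫ (restrictedYoneda M).map f.hom := rfl

instance : (restrictedYoneda M).Additive where
  map_add := by
    intro X Y f g
    refine NatTrans.ext (funext fun Q => AddCommGrpCat.ext fun (u : Q.unop.obj ⟶ X) => ?_)
    exact Preadditive.comp_add _ _ _ u f g

theorem restrictedYoneda_exact {X Y Z : M} {f : X ⟶ Y} {g : Y ⟶ Z} (w : f ≫ g = 0)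
    (h : ∀ ⦃P : M⦄ [Projective P] (x : P ⟶ Y), x ≫ g = 0 → ∃ y : P ⟶ X, y ≫ f = x) :
    (ShortComplex.mk ((restrictedYoneda M).map f) ((restrictedYoneda M).map g)
      (map_comp_eq_zero (F := restrictedYoneda M) w)).Exact :=
  exact_of_forall_exists_app_eq fun Q (x : Q.unop.obj ⟶ Y) (hx : x ≫ g = 0) =>
    have : Projective Q.unop.obj := Q.unop.property
    h x hx

theorem epi_restrictedYoneda_map {X Y : M} (f : X ⟶ Y) [Epi f] :
    Epi ((restrictedYoneda M).map f) := by
  have : ∀ Q, Epi (((restrictedYoneda M).map f).app Q) := fun Q => by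
    rw [AddCommGrpCat.epi_iff_surjective]
    intro (x : Q.unop.obj ⟶ Y)
    have : Projective Q.unop.obj := Q.unop.property
    obtain ⟨y, hy⟩ : ∃ y : Q.unop.obj ⟶ X, y ≫ f = x := ⟨_, Projective.factorThru_comp x f⟩
    exact ⟨y, hy⟩
  exact NatTrans.epi_of_epi_app _

theorem IsNAbelian.exists_weakKernel [HasFiniteBiproducts M] {n : ℕ} (hM : IsNAbelian M n)
    (hn : 1 ≤ n) {X Y : M} (f : X ⟶ Y) : ∃ (K : M) (k : K ⟶ X), IsWeakKernel k f := by
  obtain ⟨S, hSf, hS⟩ := hM.exists_nKernel f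
  obtain ⟨n, rfl⟩ := Nat.exists_eq_add_of_le' hn
  exact arrow_prop_of_eq (fun X _ f => ∃ (K : M) (k : K ⟶ X), IsWeakKernel k f) hSf.symm
    ⟨_, _, hS.1 n (by lia)⟩

/-- An epimorphism of an `n`-abelian category has a weak kernel of which it is a cokernel. -/
theorem IsNAbelian.exists_weakKernel_of_epi [HasFiniteBiproducts M] {n : ℕ} (hM : IsNAbelian M n)
    (hn : 1 ≤ n) {X Y : M} (f : X ⟶ Y) [Epi f] :
    ∃ (K : M) (k : K ⟶ X), IsWeakKernel k f ∧ IsWeakCokernel k f := by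
  obtain ⟨S, hSf, hS⟩ := hM.exists_nKernel f
  have hS' := hM.nExact_of_epi S
    (arrow_prop_of_eq (fun _ _ f => Epi f) hSf (inferInstanceAs (Epi f))) hS
  obtain ⟨n, rfl⟩ := Nat.exists_eq_add_of_le' hn
  exact arrow_prop_of_eq
    (fun X _ f => ∃ (K : M) (k : K ⟶ X), IsWeakKernel k f ∧ IsWeakCokernel k f) hSf.symm
    ⟨_, _, hS.1 n (by lia), hS'.2.1 n (by lia)⟩

variable [EnoughProjectives M]

/-- Epimorphisms from projective objects onto weak kernels give weak
kernels in the category of projective objects. -/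
theorem exists_weakKernel_proj
    (hM : ∀ ⦃X Y : M⦄ (f : X ⟶ Y), ∃ (K : M) (k : K ⟶ X), IsWeakKernel k f) ⦃P Q : Proj M⦄
    (f : P ⟶ Q) : ∃ (K : Proj M) (k : K ⟶ P), IsWeakKernel k f := by
  obtain ⟨K, k, hk⟩ := hM f.hom
  refine ⟨⟨_, Projective.projective_over K⟩, (isProjective M).homMk (Projective.π K ≫ k), ?_, ?_⟩
  · ext
    exact (Category.assoc _ _ _).trans (by rw [hk.1, comp_zero]; rfl)
  · intro Z h hh
    obtain ⟨p, hp⟩ := hk.2 h.hom (congrArg (fun f => f.hom) hh)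
    have : Projective Z.obj := Z.property
    refine ⟨(isProjective M).homMk (Projective.factorThru p (Projective.π K)), ?_⟩
    ext
    change h.hom = Projective.factorThru p (Projective.π K) ≫ Projective.π K ≫ k
    rw [Projective.factorThru_comp_assoc, hp]

theorem isCoherent_restrictedYoneda
    (hM : ∀ ⦃X Y : M⦄ (f : X ⟶ Y), ∃ (K : M) (k : K ⟶ X), IsWeakKernel k f) (X : M) :
    isCoherent (Proj M) ((restrictedYoneda M).obj X) := by
  obtain ⟨K, k, hk⟩ := hM (Projective.π X)
  let P₀ : Proj M := ⟨_, Projective.projective_over X⟩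
  let P₁ : Proj M := ⟨_, Projective.projective_over K⟩
  let f : P₁ ⟶ P₀ := (isProjective M).homMk (Projective.π K ≫ k)
  have w : (Projective.π K ≫ k) ≫ Projective.π X = 0 := by rw [Category.assoc, hk.1, comp_zero]
  have hex := restrictedYoneda_exact w fun P _ x hx => by
    obtain ⟨p, rfl⟩ := hk.2 x hx
    exact ⟨Projective.factorThru p (Projective.π K), by rw [Projective.factorThru_comp_assoc]⟩
  have hepi := epi_restrictedYoneda_map (Projective.π X)
  have w' : preadditiveYoneda.map f ≫ (projYonedaIso P₀).hom ≫
      (restrictedYoneda M).map (Projective.π X) = 0 := by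
    rw [← Category.assoc, projYonedaIso_naturality, Category.assoc, ← Functor.map_comp]
    change _ ≫ (restrictedYoneda M).map ((Projective.π K ≫ k) ≫ Projective.π X) = 0
    rw [w, Functor.map_zero, comp_zero]
  refine ⟨P₁, P₀, f, _, w', ?_, epi_comp _ _⟩
  have i : ShortComplex.mk _ _ w' ≅
      ShortComplex.mk _ _ (map_comp_eq_zero (F := restrictedYoneda M) w) :=
    ShortComplex.isoMk (projYonedaIso P₁) (projYonedaIso P₀) (Iso.refl _)
      (projYonedaIso_naturality f).symm (Category.comp_id _).symm
  exact ShortComplex.exact_of_iso i.symm hex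

theorem faithful_restrictedYoneda : (restrictedYoneda M).Faithful where
  map_injective {X Y f g} h := by
    let P₀ : Proj M := ⟨_, Projective.projective_over X⟩
    have := ConcreteCategory.congr_hom (NatTrans.congr_app h (op P₀)) (Projective.π X)
    exact (cancel_epi (Projective.π X)).1 this

/-- A natural transformation `φ` is determined by the image of an epimorphism `P₀ ⟶ X` with `P₀`
projective. That image is a morphism `P₀ ⟶ Y`, which descends to `X ⟶ Y` because `P₀ ⟶ X` is a
weak cokernel. -/
theorem full_restrictedYoneda
    (hM : ∀ ⦃X Y : M⦄ (f : X ⟶ Y) [Epi f], ∃ (K : M) (k : K ⟶ X), IsWeakCokernel k f) :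
    (restrictedYoneda M).Full where
  map_surjective {X Y} φ := by
    obtain ⟨K, k, hk⟩ := hM (Projective.π X)
    let P₀ : Proj M := ⟨_, Projective.projective_over X⟩
    let P₁ : Proj M := ⟨_, Projective.projective_over K⟩
    have nat : ∀ {P Q : Proj M} (a : P.obj ⟶ Q.obj) (b : Q.obj ⟶ X),
        φ.app (op P) (a ≫ b : P.obj ⟶ X) = (a ≫ (φ.app (op Q) b : Q.obj ⟶ Y) : P.obj ⟶ Y) :=
      fun {P Q} a b =>
        ConcreteCategory.congr_hom (φ.naturality ((isProjective M).homMk a : P ⟶ Q).op) b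
    let g : P₀.obj ⟶ Y := φ.app (op P₀) (Projective.π X)
    have hg : k ≫ g = 0 := by
      rw [← cancel_epi (Projective.π K), comp_zero, ← Category.assoc]
      refine (nat (P := P₁) (Q := P₀) (Projective.π K ≫ k) (Projective.π X)).symm.trans ?_
      rw [Category.assoc, hk.1, comp_zero]
      exact map_zero (φ.app (op P₁)).hom
    obtain ⟨h, hh⟩ := hk.2 g hg
    refine ⟨h, NatTrans.ext (funext fun Q => AddCommGrpCat.ext fun (u : Q.unop.obj ⟶ X) => ?_)⟩
    have : Projective Q.unop.obj := Q.unop.property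
    have e := Projective.factorThru_comp u (Projective.π X)
    have e' := nat (P := Q.unop) (Q := P₀) (Projective.factorThru u (Projective.π X))
      (Projective.π X)
    rw [e] at e'
    refine Eq.trans ?_ e'.symm
    change u ≫ h = Projective.factorThru u (Projective.π X) ≫ g
    rw [hh, ← Category.assoc, e]

end Projectives

/-! ### The functor to coherent modules -/

section CohYoneda

variable {M : Type u} [Category.{v} M] [Preadditive M]

theorem isPresentingFunctor_cohYoneda [(isCoherent (Proj M)).ContainsZero]
    [(isCoherent (Proj M)).IsClosedUnderKernels] [(isCoherent (Proj M)).IsClosedUnderCokernels]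
    [(isCoherent (Proj M)).IsClosedUnderFiniteProducts]
    (hF : ∀ X : M, isCoherent (Proj M) ((restrictedYoneda M).obj X)) :
    IsPresentingFunctor (cohYoneda M hF) := by
  let ι := (isCoherent (Proj M)).ι
  have : ι.PreservesHomology :=
    { preservesKernels := (isCoherent (Proj M)).preservesKernels_ι
      preservesCokernels := (isCoherent (Proj M)).preservesCokernels_ι }
  refine ⟨?_, ?_, ?_, ?_⟩
  · intro X Y Z f g h w
    rw [← ShortComplex.exact_map_iff_of_faithful _ ι]
    exact restrictedYoneda_exact h.1 fun P _ x hx => (h.2 x hx).imp fun _ h => h.symm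
  · intro X Y f hf
    exact ι.epi_of_epi_map (epi_restrictedYoneda_map f)
  · refine fun P hP => ⟨fun {E G} φ e he => ?_⟩
    have := additive_of_isCoherent E.property
    have : Epi e.hom :=
      have := (isCoherent (Proj M)).preservesEpimorphisms_ι_of_isNormalMonoCategory
      inferInstanceAs (Epi (ι.map e))
    let i := projYonedaIso (⟨P, hP⟩ : Proj M)
    obtain ⟨ψ, hψ⟩ := exists_lift_of_epi e.hom (i.hom ≫ φ.hom)
    refine ⟨(isCoherent (Proj M)).homMk (i.inv ≫ ψ), ?_⟩
    ext1
    change (i.inv ≫ ψ) ≫ e.hom = φ.hom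
    rw [Category.assoc, hψ, Iso.inv_hom_id_assoc]
  · intro X
    obtain ⟨U, V, f, p, w, hex, hp⟩ := X.property
    have w' : (restrictedYoneda M).map f.hom ≫ (projYonedaIso V).inv ≫ p = 0 := by
      rw [← cancel_epi (projYonedaIso U).hom, ← Category.assoc, ← projYonedaIso_naturality]
      simp [w]
    refine ⟨U.obj, V.obj, f.hom, (isCoherent (Proj M)).homMk ((projYonedaIso V).inv ≫ p),
      ?_, ?_, ?_⟩
    · ext1
      exact w'
    · rw [← ShortComplex.exact_map_iff_of_faithful _ ι]
      have i : ShortComplex.mk _ _ w ≅ ShortComplex.mk _ _ w' :=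
        ShortComplex.isoMk (projYonedaIso U) (projYonedaIso V) (Iso.refl _)
          (projYonedaIso_naturality f).symm (by simp)
      exact ShortComplex.exact_of_iso i hex
    · exact ι.epi_of_epi_map (inferInstanceAs (Epi ((projYonedaIso V).inv ≫ p)))

end CohYoneda

end HigherHomological

theorem mainTheorem2 {M : Type u} [Category.{v} M] [Preadditive M] [HasFiniteBiproducts M]
    (n : ℕ) (hn : 1 ≤ n) (hM : IsNAbelian M n) (hP : EnoughProjectives M) :
    ∃ (hF : ∀ X : M, isCoherent (Proj M) ((restrictedYoneda M).obj X))
      (_ : Abelian (CohMod (Proj M))),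
      (cohYoneda M hF).Full ∧ (cohYoneda M hF).Faithful ∧
      (∀ k : ℕ, 1 ≤ k → k < n → ∀ X Y : M,
        ExtVanishes ((cohYoneda M hF).obj X) ((cohYoneda M hF).obj Y) k) ∧
      (cohYoneda M hF).essImage = leftExtPerp n (cohYoneda M hF).essImage ∧
      (cohYoneda M hF).essImage = rightExtPerp n (cohYoneda M hF).essImage ∧
      IsContravariantlyFinite (cohYoneda M hF).essImage ∧
      (EnoughInjectives (CohMod (Proj M)) →
        IsNClusterTilting n (cohYoneda M hF).essImage) := by
  have hwk : ∀ ⦃X Y : M⦄ (f : X ⟶ Y), ∃ (K : M) (k : K ⟶ X), IsWeakKernel k f :=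
    fun _ _ f => hM.exists_weakKernel hn f
  have := hasFiniteBiproducts_proj (M := M)
  have := containsZero_isCoherent (C := Proj M)
  have := isClosedUnderCokernels_isCoherent (C := Proj M)
  have := isClosedUnderKernels_isCoherent (exists_weakKernel_proj hwk)
  have := isClosedUnderFiniteProducts_isCoherent (C := Proj M)
  have hF := isCoherent_restrictedYoneda hwk
  have := faithful_restrictedYoneda (M := M)
  have := full_restrictedYoneda (M := M) fun X Y f _ =>
    (hM.exists_weakKernel_of_epi hn f).imp fun K ⟨k, hk⟩ => ⟨k, hk.2⟩
  have hfull : (cohYoneda M hF).Full := inferInstance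
  have hfaithful : (cohYoneda M hF).Faithful := inferInstance
  have hadd : (cohYoneda M hF).Additive :=
    ⟨fun {X Y f g} => by ext1; exact (restrictedYoneda M).map_add⟩
  have h := isPresentingFunctor_cohYoneda hF
  exact ⟨hF, inferInstance, hfull, hfaithful, fun k hk hkn X Y => h.extVanishes hM hk hkn X Y,
    h.essImage_properties hM hn⟩
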